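/- Let $\tfrac12<\alpha,\beta<1$ and $T,S>0$, and let $B$ be a standard Brownian sheet on $[0,\infty)^2$ (centred Gaussian, $E[B(t,s)B(t',s')]=(t\wedge t')(s\wedge s')$). For $\zeta$ square integrable on $[0,t]^2\times[0,s]^2$ write $$M_{t,s}(\zeta)=\int_0^t\!\int_0^s\!\int_0^t\!\int_0^s \zeta(y_1,y_2,u_1,u_2)\,B(dy_1,du_1)B(dy_2,du_2)$$ for the double Wiener integral. Let $\mathrm B(\cdot,\cdot)$ denote the Beta function, $H'=\frac{H+1}2$, and $$c_H=\sqrt{\tfrac{H(2H-1)}{\mathrm B(2-2H,H-\frac12)}},\qquad d_H=\tfrac1{H+1}\sqrt{\tfrac{2(2H-1)}{H}},\qquad K^H(t,s)=c_H s^{\frac12-H}\int_s^t(u-s)^{H-\frac32}u^{H-\frac12}\,du\quad(t>s>0),$$ $$Q_H(t,y_1,y_2)=d_H 1_{[0,t]}(y_1)1_{[0,t]}(y_2)\int_{y_1\vee y_2}^t\frac{\partial K^{H'}}{\partial x}(x,y_1)\frac{\partial K^{H'}}{\partial x}(x,y_2)\,dx .$$ The Rosenblatt sheet is $Z^{\alpha,\beta}(t,s)=M_{t,s}(\zeta)$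 with $\zeta(y_1,y_2,u_1,u_2)=Q_\alpha(t,y_1,y_2)Q_\beta(s,u_1,u_2)$. Let $$C_2(\alpha)=d_\alpha c_{\alpha'}^2\int_0^1\!\int_0^s r^{-\alpha}(1-s)^{\frac\alpha2-1}(1-r)^{\frac\alpha2-1}(s-r)^{\alpha-1}\,dr\,ds$$ and let $\mathcal K_2=\{\zeta_k: k>0\}$, where $$\zeta_k(y_1,y_2,u_1,u_2)=k\,(y_1\vee y_2)^{\frac\alpha2}(y_1\wedge y_2)^{-\frac\alpha2}|y_1-y_2|^{\alpha-1}(u_1\vee u_2)^{\frac\beta2}(u_1\wedge u_2)^{-\frac\beta2}|u_1-u_2|^{\beta-1}.$$ Then $$\inf_{\zeta\in\mathcal K_2}\ \sup_{t\in[0,T],\,s\in[0,S]}2E\big(Z^{\alpha,\beta}(t,s)-M_{t,s}(\zeta)\big)^2=\Big(1-\frac{4C_2(\alpha)^2C_2(\beta)^2}{\alpha\beta\,\mathrm B(1-\alpha,2\alpha-1)\mathrm B(1-\beta,2\beta-1)}\Big)T^{2\alpha}S^{2\beta},$$ every one of these suprema is finite, and the infimum is attained at $\zeta_{k^*}$ with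 $$k^*=\frac{C_2(\alpha)C_2(\beta)}{\mathrm B(1-\alpha,2\alpha-1)\mathrm B(1-\beta,2\beta-1)}>0 .$$ -/

import Mathlib

open MeasureTheory ProbabilityTheory Filter Topology
open scoped NNReal ENNReal

noncomputable section

namespace RosenblattSheet

/-! ## Brownian sheet -/

/-- `B` is a standard Brownian sheet on `[0,∞)²`: a centred Gaussian random field with
covariance `E[B(t,s) B(t',s')] = (t ∧ t') (s ∧ s')`.  No regularity of the paths is required,
since the integrals below do not depend on it. -/
structure IsBrownianSheet {Ω : Type*} [MeasurableSpace Ω]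
    (B : ℝ≥0 × ℝ≥0 → Ω → ℝ) (P : Measure Ω) : Prop where
  gaussian : IsGaussianProcess B P
  centered : ∀ p, ∫ ω, B p ω ∂P = 0
  covariance_eq : ∀ p q, ∫ ω, B p ω * B q ω ∂P = ((min p.1 q.1 * min p.2 q.2 : ℝ≥0) : ℝ)

/-! ## Double Wiener integrals -/

/-- A rectangle `(a,b] × (c,d]` in the quadrant `[0,∞)²`. -/
structure Rect where
  a : ℝ≥0
  b : ℝ≥0
  c : ℝ≥0
  d : ℝ≥0
  hab : a ≤ b
  hcd : c ≤ d

/-- The rectangle as a subset of the plane. -/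
def Rect.toSet (R : Rect) : Set (ℝ × ℝ) :=
  Set.Ioc (R.a : ℝ) (R.b : ℝ) ×ˢ Set.Ioc (R.c : ℝ) (R.d : ℝ)

/-- The mass `B((a,b] × (c,d])` which the sheet gives to a rectangle. -/
def Rect.increment {Ω : Type*} (R : Rect) (B : ℝ≥0 × ℝ≥0 → Ω → ℝ) (ω : Ω) : ℝ :=
  B (R.b, R.d) ω - B (R.a, R.d) ω - B (R.b, R.c) ω + B (R.a, R.c) ω

/-- An elementary integrand `∑ₖ cₖ 1_{Rₖ × R'ₖ}` for the double integral, where every product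
`Rₖ × R'ₖ` avoids the diagonal. -/
structure Elementary where
  n : ℕ
  coef : Fin n → ℝ
  left : Fin n → Rect
  right : Fin n → Rect
  disjoint : ∀ k, Disjoint (left k).toSet (right k).toSet

/-- The elementary integrand as a function of two points of the plane. -/
def Elementary.toFun (F : Elementary) (z : (ℝ × ℝ) × (ℝ × ℝ)) : ℝ :=
  ∑ k, F.coef k * ((F.left k).toSet ×ˢ (F.right k).toSet).indicator (fun _ => (1 : ℝ)) z

/-- The double integral `∑ₖ cₖ B(Rₖ) B(R'ₖ)` of an elementary integrand. -/
def Elementary.integral {Ω : Type*} (F : Elementary) (B : ℝ≥0 × ℝ≥0 → Ω → ℝ) (ω : Ω) : ℝ :=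
  ∑ k, F.coef k * (F.left k).increment B ω * (F.right k).increment B ω

/-- `X` is (a version of) the double Wiener integral of `g` with respect to `B`: the
mean-square limit of the integrals of elementary integrands that converge to `g` in `L²`. -/
def IsDoubleWienerIntegral {Ω : Type*} [MeasurableSpace Ω]
    (B : ℝ≥0 × ℝ≥0 → Ω → ℝ) (P : Measure Ω) (g : (ℝ × ℝ) × (ℝ × ℝ) → ℝ) (X : Ω → ℝ) : Prop :=
  MemLp X 2 P ∧ ∃ F : ℕ → Elementary,
    Tendsto (fun n => eLpNorm (fun z => (F n).toFun z - g z) 2 volume) atTop (𝓝 0) ∧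
    Tendsto (fun n => eLpNorm (fun ω => (F n).integral B ω - X ω) 2 P) atTop (𝓝 0)

open Classical in
/-- The double Wiener integral of `g` with respect to `B`, determined up to null sets
(and `0` if there is none). -/
def doubleWienerIntegral {Ω : Type*} [MeasurableSpace Ω]
    (B : ℝ≥0 × ℝ≥0 → Ω → ℝ) (P : Measure Ω) (g : (ℝ × ℝ) × (ℝ × ℝ) → ℝ) : Ω → ℝ :=
  if h : ∃ X, IsDoubleWienerIntegral B P g X then h.choose else 0

/-- `∫₀ᵗ∫₀ˢ∫₀ᵗ∫₀ˢ ζ(y₁,y₂,u₁,u₂) B(dy₁,du₁) B(dy₂,du₂)`. -/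
def doubleIntegral {Ω : Type*} [MeasurableSpace Ω]
    (B : ℝ≥0 × ℝ≥0 → Ω → ℝ) (P : Measure Ω) (t s : ℝ) (ζ : ℝ → ℝ → ℝ → ℝ → ℝ) : Ω → ℝ :=
  doubleWienerIntegral B P
    (((Set.Icc 0 t ×ˢ Set.Icc 0 s) ×ˢ (Set.Icc 0 t ×ˢ Set.Icc 0 s)).indicator
      fun z : (ℝ × ℝ) × (ℝ × ℝ) => ζ z.1.1 z.2.1 z.1.2 z.2.2)

/-! ## The Rosenblatt sheet -/

/-- `c_H = √(H(2H-1) / B(2-2H, H-1/2))`. -/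
def cConst (H : ℝ) : ℝ :=
  Real.sqrt (H * (2 * H - 1) / beta (2 - 2 * H) (H - 1 / 2))

/-- The kernel `K^H(t,s) = c_H s^{1/2-H} ∫ₛᵗ (u-s)^{H-3/2} u^{H-1/2} du`, used for `t > s > 0`. -/
def kernelK (H t s : ℝ) : ℝ :=
  cConst H * s ^ (1 / 2 - H) * ∫ u in s..t, (u - s) ^ (H - 3 / 2) * u ^ (H - 1 / 2)

/-- `d_H = (1/(H+1)) √(2(2H-1)/H)`, which normalizes the Rosenblatt process of index `H`
to have variance `t^{2H}`. -/
def dConst (H : ℝ) : ℝ :=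
  1 / (H + 1) * Real.sqrt (2 * (2 * H - 1) / H)

/-- The kernel of the Rosenblatt process,
`Q_H(t,y₁,y₂) = d_H 1_{[0,t]}(y₁) 1_{[0,t]}(y₂) ∫_{y₁∨y₂}^t ∂ₓK^{H'}(x,y₁) ∂ₓK^{H'}(x,y₂) dx`
with `H' = (H+1)/2`. -/
def kernelQ (H t y₁ y₂ : ℝ) : ℝ :=
  dConst H * (Set.Icc 0 t).indicator (fun _ => (1 : ℝ)) y₁ *
    (Set.Icc 0 t).indicator (fun _ => (1 : ℝ)) y₂ *
    ∫ x in (max y₁ y₂)..t,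
      deriv (fun x' => kernelK ((H + 1) / 2) x' y₁) x *
      deriv (fun x' => kernelK ((H + 1) / 2) x' y₂) x

/-- The Rosenblatt sheet `Z^{α,β}(t,s)` driven by `B`. -/
def rosenblattSheet {Ω : Type*} [MeasurableSpace Ω]
    (B : ℝ≥0 × ℝ≥0 → Ω → ℝ) (P : Measure Ω) (α β t s : ℝ) : Ω → ℝ :=
  doubleIntegral B P t s fun y₁ y₂ u₁ u₂ => kernelQ α t y₁ y₂ * kernelQ β s u₁ u₂

/-! ## The approximation problem -/

/-- The kernel `k (y₁∨y₂)^{α/2} (y₁∧y₂)^{-α/2} |y₁-y₂|^{α-1}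
(u₁∨u₂)^{β/2} (u₁∧u₂)^{-β/2} |u₁-u₂|^{β-1}`. -/
def secondKernel (α β k y₁ y₂ u₁ u₂ : ℝ) : ℝ :=
  k * (max y₁ y₂ ^ (α / 2) * min y₁ y₂ ^ (-α / 2) * |y₁ - y₂| ^ (α - 1)) *
    (max u₁ u₂ ^ (β / 2) * min u₁ u₂ ^ (-β / 2) * |u₁ - u₂| ^ (β - 1))

/-- The class `𝒦₂` of positive multiples of the second kernel. -/
def classK₂ (α β : ℝ) : Set (ℝ → ℝ → ℝ → ℝ → ℝ) :=
  {ζ | ∃ k : ℝ, 0 < k ∧ ζ = secondKernel α β k}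

/-- `2 E (Z^{α,β}(t,s) - M_{t,s}(ζ))²`. -/
def sqError {Ω : Type*} [MeasurableSpace Ω] (B : ℝ≥0 × ℝ≥0 → Ω → ℝ) (P : Measure Ω)
    (α β : ℝ) (ζ : ℝ → ℝ → ℝ → ℝ → ℝ) (t s : ℝ) : ℝ :=
  2 * ∫ ω, (rosenblattSheet B P α β t s ω - doubleIntegral B P t s ζ ω) ^ 2 ∂P

/-- The set of values of `2 E (Z^{α,β}(t,s) - M_{t,s}(ζ))²` over `t ∈ [0,T]`, `s ∈ [0,S]`. -/
def errorValues {Ω : Type*} [MeasurableSpace Ω] (B : ℝ≥0 × ℝ≥0 → Ω → ℝ) (P : Measure Ω)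
    (α β T S : ℝ) (ζ : ℝ → ℝ → ℝ → ℝ → ℝ) : Set ℝ :=
  {e | ∃ t ∈ Set.Icc 0 T, ∃ s ∈ Set.Icc 0 S, e = sqError B P α β ζ t s}

/-- `C₂(α) = d_α c²_{α'} ∫₀¹∫₀ˢ r^{-α} (1-s)^{α/2-1} (1-r)^{α/2-1} (s-r)^{α-1} dr ds`
with `α' = (α+1)/2`. -/
def C₂ (α : ℝ) : ℝ :=
  dConst α * cConst ((α + 1) / 2) ^ 2 *
    ∫ s in (0 : ℝ)..1, ∫ r in (0 : ℝ)..s,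
      r ^ (-α) * (1 - s) ^ (α / 2 - 1) * (1 - r) ^ (α / 2 - 1) * (s - r) ^ (α - 1)

/-- `B(1-α,2α-1) B(1-β,2β-1)`. -/
def betaProd (α β : ℝ) : ℝ :=
  beta (1 - α) (2 * α - 1) * beta (1 - β) (2 * β - 1)

/-- `k* = C₂(α) C₂(β) / (B(1-α,2α-1) B(1-β,2β-1))`. -/
def kStar (α β : ℝ) : ℝ :=
  C₂ α * C₂ β / betaProd α β

/-- `(1 - 4 C₂(α)² C₂(β)² / (α β B(1-α,2α-1) B(1-β,2β-1))) T^{2α} S^{2β}`. -/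
def optimalValue (α β T S : ℝ) : ℝ :=
  (1 - 4 * C₂ α ^ 2 * C₂ β ^ 2 / (α * β * betaProd α β)) * T ^ (2 * α) * S ^ (2 * β)

end RosenblattSheet

end

noncomputable section

namespace RosenblattSheet

section

/-! ## Fourth moments of Gaussian variables -/

/-! The error is an explicit quadratic polynomial in k times T^{2α} S^{2β}, and the theorem
completes its square.

Isometry. For symmetric g and h, E(I(g) - I(h))² = 2‖g - h‖². For elementary integrands this is
Isserlis' formula, obtained by polarizing the Gaussian fourth moment; the pairing inside one term
vanishes because its two rectangles are disjoint. Density of elementary integrands, which rests on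
Lebesgue differentiation off the diagonal, then gives existence of the integral and the isometry in
L² (`IsBrownianSheet.integral_sub_sq`).

Kernels. Both integrands are tensor products of a factor in (y₁,y₂) and a factor in (u₁,u₂), so
everything reduces to three integrals over the plane, with w the unit kernel (k = 1) on [0,t]²:
‖Q_α‖² = t^{2α}/2, ⟨Q_α, w⟩ = C₂(α) t^{2α}/α, ‖w‖² = B(1-α,2α-1) t^{2α}/α. The first uses ∫ ∂K(x,y)
∂K(x',y) dy ∝ |x - x'|^{α-1}, proved by a Möbius substitution (`lintegral_derivKernel_mul_of_lt`);
the other two follow from homogeneity. They are computed with values in `ℝ≥0∞`, so that Tonelli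
needs no integrability; finiteness is read off afterwards.

Optimization. `sqError_secondKernel` shows that the error is `errorCoeff α β k` times t^{2α} s^{2β}.
The coefficient is nonnegative, being itself a mean square, so the supremum sits at (T,S); its
minimum over k is at the vertex `kStar`, which is positive. -/

lemma integral_pow_four_gaussianReal (v : ℝ≥0) :
    ∫ x, x ^ 4 ∂(gaussianReal 0 v) = 3 * (v : ℝ) ^ 2 := by
  have h := iteratedDeriv_mgf_zero (X := fun x : ℝ => x) (μ := gaussianReal 0 v) (by simp) 4
  -- Differentiation sends p·exp(vt²/2) to (p' + vtp)·exp(vt²/2). Four rounds starting from p = 1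
  -- leave a polynomial with constant term 3v².
  have e : ∀ (p p' : ℝ → ℝ), (∀ t, HasDerivAt p (p' t) t) →
      deriv (fun t => p t * Real.exp (v * t ^ 2 / 2)) =
        fun t => (p' t + p t * (v * t)) * Real.exp (v * t ^ 2 / 2) := by
    intro p p' hp
    funext t
    have h1 : HasDerivAt (fun t : ℝ => (v : ℝ) * t ^ 2 / 2) (v * t) t := by
      have := ((hasDerivAt_pow 2 t).const_mul (v : ℝ)).div_const 2
      convert! this using 1
      simp; ring
    rw [((hp t).fun_mul h1.exp).deriv]
    ring
  have e0 : mgf (fun x : ℝ => x) (gaussianReal 0 v)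
      = fun t => (fun _ => (1 : ℝ)) t * Real.exp (v * t ^ 2 / 2) := by
    rw [mgf_fun_id_gaussianReal]; simp
  rw [e0, iteratedDeriv_succ, iteratedDeriv_succ, iteratedDeriv_succ, iteratedDeriv_one,
    e _ (fun _ => 0) (fun t => hasDerivAt_const _ _),
    e _ (fun _ => (v : ℝ)) (fun t => by simpa using (hasDerivAt_id t).const_mul (v : ℝ)),
    e _ (fun t => 2 * (v : ℝ) ^ 2 * t) (fun t => by
      have := ((hasDerivAt_pow 2 t).const_mul ((v : ℝ) ^ 2)).const_add (v : ℝ)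
      convert! this using 1
      · funext s; simp; ring
      · simp; ring),
    e _ (fun t => 3 * (v : ℝ) ^ 2 + 3 * (v : ℝ) ^ 3 * t ^ 2) (fun t => by
      have := ((hasDerivAt_id t).const_mul (3 * (v : ℝ) ^ 2)).add
        ((hasDerivAt_pow 3 t).const_mul ((v : ℝ) ^ 3))
      convert! this using 1
      · funext s; simp; ring
      · simp; ring)] at h
  simpa using h.symm

variable {Ω : Type*} [MeasurableSpace Ω] {P : Measure Ω}

lemma integral_pow_four_of_hasGaussianLaw {X : Ω → ℝ} (hX : HasGaussianLaw X P)
    (h0 : ∫ ω, X ω ∂P = 0) : ∫ ω, X ω ^ 4 ∂P = 3 * (∫ ω, X ω ^ 2 ∂P) ^ 2 := by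
  have h1 := integral_map (μ := P) hX.aemeasurable (f := fun x : ℝ => x ^ 4)
    (by fun_prop)
  rw [← h1, hX.map_eq_gaussianReal, h0, integral_pow_four_gaussianReal,
    variance_of_integral_eq_zero hX.aemeasurable h0, Real.coe_toNNReal]
  exact integral_nonneg fun ω => sq_nonneg _

variable {B : ℝ≥0 × ℝ≥0 → Ω → ℝ}

/-- The linear space spanned by the values of a random field. -/
def linearSpan (B : ℝ≥0 × ℝ≥0 → Ω → ℝ) : Submodule ℝ (Ω → ℝ) := Submodule.span ℝ (Set.range B)

/-- Only finitely many values of the field enter, and a linear functional of a Gaussian vector is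
Gaussian. -/
lemma IsBrownianSheet.hasGaussianLaw (hB : IsBrownianSheet B P) {X : Ω → ℝ}
    (hX : X ∈ linearSpan B) : HasGaussianLaw X P := by
  obtain ⟨c, rfl⟩ := Finsupp.mem_span_range_iff_exists_finsupp.1 hX
  have h := (hB.gaussian.hasGaussianLaw c.support).map
    (∑ i : c.support, c i • ContinuousLinearMap.proj (R := ℝ) (φ := fun _ : c.support => ℝ) i)
  convert! h using 1
  ext ω
  simp only [Finsupp.sum, Finset.sum_apply, Pi.smul_apply, smul_eq_mul, Function.comp_apply,
    _root_.sum_apply, _root_.smul_apply, ContinuousLinearMap.proj_apply,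
    Finset.restrict]
  exact (Finset.sum_coe_sort c.support (fun i => c i * B i ω)).symm

lemma IsBrownianSheet.integral_eq_zero (hB : IsBrownianSheet B P) {X : Ω → ℝ}
    (hX : X ∈ linearSpan B) : ∫ ω, X ω ∂P = 0 := by
  refine Submodule.span_induction (p := fun X _ => ∫ ω, X ω ∂P = 0) ?_ ?_ ?_ ?_ hX
  · rintro _ ⟨p, rfl⟩
    exact hB.centered p
  · simp
  · intro x y hx hy h1 h2
    have := integral_add (hB.hasGaussianLaw hx).integrable (hB.hasGaussianLaw hy).integrable
    simp only [Pi.add_apply]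
    rw [this, h1, h2, add_zero]
  · intro a x _ h1
    simp only [Pi.smul_apply, smul_eq_mul, integral_const_mul, h1, mul_zero]

lemma IsBrownianSheet.memLp (hB : IsBrownianSheet B P) {X : Ω → ℝ}
    (hX : X ∈ linearSpan B) {p : ℝ≥0∞} (hp : p ≠ ∞) : MemLp X p P :=
  (hB.hasGaussianLaw hX).memLp hp

lemma IsBrownianSheet.memLp_mul (hB : IsBrownianSheet B P) {X Y : Ω → ℝ}
    (hX : X ∈ linearSpan B) (hY : Y ∈ linearSpan B) : MemLp (fun ω => X ω * Y ω) 2 P := by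
  have : ENNReal.HolderTriple 4 4 2 := ⟨by
    have : (4 : ℝ≥0∞) = 2 * 2 := by norm_num
    rw [this, ENNReal.mul_inv (by simp) (by simp), ← mul_add, ENNReal.inv_two_add_inv_two, mul_one]⟩
  exact (hB.memLp hY (p := 4) (by simp)).mul (hB.memLp hX (p := 4) (by simp))

lemma integrable_mul_of_memLp_two {α : Type*} [MeasurableSpace α] {μ : Measure α} {x y : α → ℝ}
    (hx : MemLp x 2 μ) (hy : MemLp y 2 μ) : Integrable (fun ω => x ω * y ω) μ :=
  hx.integrable_mul hy

lemma integral_add_mul_mul {α : Type*} [MeasurableSpace α] {μ : Measure α} {x y z : α → ℝ}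
    (hx : MemLp x 2 μ) (hy : MemLp y 2 μ) (hz : MemLp z 2 μ) (e : ℝ) :
    ∫ ω, (x ω + e * y ω) * z ω ∂μ = ∫ ω, x ω * z ω ∂μ + e * ∫ ω, y ω * z ω ∂μ := by
  rw [← integral_const_mul, ← integral_add (integrable_mul_of_memLp_two hx hz)
    ((integrable_mul_of_memLp_two hy hz).const_mul e)]
  exact integral_congr_ae (ae_of_all _ fun ω => by simp only; ring)

lemma integral_add_mul_sq {α : Type*} [MeasurableSpace α] {μ : Measure α} {x y : α → ℝ}
    (hx : MemLp x 2 μ) (hy : MemLp y 2 μ) (e : ℝ) :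
    ∫ ω, (x ω + e * y ω) ^ 2 ∂μ =
      ∫ ω, x ω ^ 2 ∂μ + 2 * e * ∫ ω, x ω * y ω ∂μ + e ^ 2 * ∫ ω, y ω ^ 2 ∂μ := by
  have h1 := (integrable_mul_of_memLp_two hx hy).const_mul (2 * e)
  rw [← integral_const_mul, ← integral_const_mul, ← integral_add hx.integrable_sq h1,
    ← integral_add (hx.integrable_sq.fun_add h1) (hy.integrable_sq.const_mul _)]
  exact integral_congr_ae (ae_of_all _ fun ω => by simp only; ring)

/-- Isserlis' formula for four jointly Gaussian centred variables. -/
lemma IsBrownianSheet.integral_mul_four (hB : IsBrownianSheet B P) {a b c d : Ω → ℝ}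
    (ha : a ∈ linearSpan B) (hb : b ∈ linearSpan B) (hc : c ∈ linearSpan B)
    (hd : d ∈ linearSpan B) :
    ∫ ω, (a ω * b ω) * (c ω * d ω) ∂P =
      (∫ ω, a ω * b ω ∂P) * (∫ ω, c ω * d ω ∂P) + (∫ ω, a ω * c ω ∂P) * (∫ ω, b ω * d ω ∂P) +
        (∫ ω, a ω * d ω ∂P) * (∫ ω, b ω * c ω ∂P) := by
  have mem : ∀ e f g : ℝ, (fun ω => ((a ω + e * b ω) + f * c ω) + g * d ω) ∈ linearSpan B :=
    fun e f g => add_mem (add_mem (add_mem ha (Submodule.smul_mem _ e hb))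
      (Submodule.smul_mem _ f hc)) (Submodule.smul_mem _ g hd)
  -- A linear combination is centred Gaussian, so its fourth moment is three times the square of a
  -- quadratic form in the coefficients.
  have key : ∀ e f g : ℝ, ∫ ω, (((a ω + e * b ω) + f * c ω) + g * d ω) ^ 4 ∂P =
      3 * (∫ ω, a ω ^ 2 ∂P + 2 * e * ∫ ω, a ω * b ω ∂P + e ^ 2 * ∫ ω, b ω ^ 2 ∂P +
        2 * f * (∫ ω, a ω * c ω ∂P + e * ∫ ω, b ω * c ω ∂P) + f ^ 2 * ∫ ω, c ω ^ 2 ∂P +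
        2 * g * (∫ ω, a ω * d ω ∂P + e * ∫ ω, b ω * d ω ∂P + f * ∫ ω, c ω * d ω ∂P) +
        g ^ 2 * ∫ ω, d ω ^ 2 ∂P) ^ 2 := by
    intro e f g
    have La := hB.memLp ha (p := 2) (by simp)
    have Lb := hB.memLp hb (p := 2) (by simp)
    have Lc := hB.memLp hc (p := 2) (by simp)
    have Ld := hB.memLp hd (p := 2) (by simp)
    have Lab : MemLp (fun ω => a ω + e * b ω) 2 P := La.add (Lb.const_mul e)
    have Labc : MemLp (fun ω => (a ω + e * b ω) + f * c ω) 2 P := Lab.add (Lc.const_mul f)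
    rw [integral_pow_four_of_hasGaussianLaw (hB.hasGaussianLaw (mem e f g))
      (hB.integral_eq_zero (mem e f g)), integral_add_mul_sq Labc Ld, integral_add_mul_sq Lab Lc,
      integral_add_mul_sq La Lb, integral_add_mul_mul Lab Lc Ld, integral_add_mul_mul La Lb Ld,
      integral_add_mul_mul La Lb Lc]
  have int4 : ∀ e f g : ℝ, Integrable (fun ω => (((a ω + e * b ω) + f * c ω) + g * d ω) ^ 4) P := by
    intro e f g
    have := (hB.memLp_mul (mem e f g) (mem e f g)).integrable_sq
    refine this.congr (ae_of_all _ fun ω => ?_)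
    simp only
    ring
  -- Polarization: weighting the eight fourth powers by the product of their signs leaves only abcd,
  -- with coefficient 8 · 4! = 192.
  have pol : ∀ ω, (a ω * b ω) * (c ω * d ω) = ((a ω + 1 * b ω + 1 * c ω + 1 * d ω) ^ 4
      - (a ω + 1 * b ω + 1 * c ω + (-1) * d ω) ^ 4 - (a ω + 1 * b ω + (-1) * c ω + 1 * d ω) ^ 4
      - (a ω + (-1) * b ω + 1 * c ω + 1 * d ω) ^ 4 + (a ω + 1 * b ω + (-1) * c ω + (-1) * d ω) ^ 4
      + (a ω + (-1) * b ω + 1 * c ω + (-1) * d ω) ^ 4 + (a ω + (-1) * b ω + (-1) * c ω + 1 * d ω) ^ 4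
      - (a ω + (-1) * b ω + (-1) * c ω + (-1) * d ω) ^ 4) / 192 := fun ω => by ring
  simp_rw [pol]
  rw [integral_div, integral_sub, integral_add, integral_add, integral_add, integral_sub,
    integral_sub, integral_sub]
  · simp only [key]
    ring
  all_goals
    repeat' first
      | exact int4 _ _ _
      | apply Integrable.sub
      | apply Integrable.add

end

section

variable {Ω : Type*} {B : ℝ≥0 × ℝ≥0 → Ω → ℝ}

/-! ## Operations on elementary integrands -/

/-- The sum of two elementary integrands. -/
def Elementary.add (F G : Elementary) : Elementary where
  n := F.n + G.n
  coef := Fin.append F.coef G.coef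
  left := Fin.append F.left G.left
  right := Fin.append F.right G.right
  disjoint k := by
    refine Fin.addCases (fun i => ?_) (fun i => ?_) k
    · simpa using F.disjoint i
    · simpa using G.disjoint i

/-- A multiple of an elementary integrand. -/
def Elementary.smul (a : ℝ) (F : Elementary) : Elementary where
  n := F.n
  coef k := a * F.coef k
  left := F.left
  right := F.right
  disjoint := F.disjoint

lemma Elementary.toFun_add (F G : Elementary) (z : (ℝ × ℝ) × (ℝ × ℝ)) :
    (F.add G).toFun z = F.toFun z + G.toFun z := by
  simp only [Elementary.toFun, Elementary.add]
  refine (Fin.sum_univ_add _).trans ?_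
  simp

lemma Elementary.integral_add (F G : Elementary) (ω : Ω) :
    (F.add G).integral B ω = F.integral B ω + G.integral B ω := by
  simp only [Elementary.integral, Elementary.add]
  refine (Fin.sum_univ_add _).trans ?_
  simp

lemma Elementary.toFun_smul (a : ℝ) (F : Elementary) (z : (ℝ × ℝ) × (ℝ × ℝ)) :
    (F.smul a).toFun z = a * F.toFun z := by
  simp only [Elementary.toFun, Elementary.smul, Finset.mul_sum, mul_assoc]
  rfl

lemma Elementary.integral_smul (a : ℝ) (F : Elementary) (ω : Ω) :
    (F.smul a).integral B ω = a * F.integral B ω := by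
  simp only [Elementary.integral, Elementary.smul, Finset.mul_sum, mul_assoc]
  rfl

/-! ## The isometry for elementary integrands -/

/-- The corners of a rectangle. -/
def Rect.corner (R : Rect) : Fin 4 → ℝ≥0 × ℝ≥0 :=
  ![(R.b, R.d), (R.a, R.d), (R.b, R.c), (R.a, R.c)]

/-- The signs with which the corners of a rectangle enter its increment. -/
def cornerSign : Fin 4 → ℝ := ![1, -1, -1, 1]

lemma Rect.increment_eq_sum (R : Rect) (ω : Ω) :
    R.increment B ω = ∑ i, cornerSign i * B (R.corner i) ω := by
  simp [Rect.increment, Fin.sum_univ_four, cornerSign, Rect.corner]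
  ring

lemma Rect.increment_mem (R : Rect) : R.increment B ∈ linearSpan B := by
  have h : ∀ p, B p ∈ linearSpan B := fun p => Submodule.subset_span ⟨p, rfl⟩
  exact add_mem (sub_mem (sub_mem (h _) (h _)) (h _)) (h _)

variable [MeasurableSpace Ω] {P : Measure Ω}

/-- The indicator function of a rectangle. -/
def Rect.ind (R : Rect) (p : ℝ × ℝ) : ℝ := R.toSet.indicator (fun _ => (1 : ℝ)) p

lemma Rect.measurableSet_toSet (R : Rect) : MeasurableSet R.toSet :=
  measurableSet_Ioc.prod measurableSet_Ioc

lemma Rect.measurable_ind (R : Rect) : Measurable R.ind :=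
  measurable_const.indicator R.measurableSet_toSet

lemma Rect.volume_toSet_lt_top (R : Rect) : volume R.toSet < ∞ := by
  rw [Rect.toSet, Measure.volume_eq_prod, Measure.prod_prod]
  exact ENNReal.mul_lt_top (by simp) (by simp)

lemma Rect.ind_mul_ind (R Q : Rect) (p : ℝ × ℝ) :
    R.ind p * Q.ind p = (R.toSet ∩ Q.toSet).indicator (fun _ => (1 : ℝ)) p := by
  by_cases h1 : p ∈ R.toSet <;> by_cases h2 : p ∈ Q.toSet <;> simp [Rect.ind, h1, h2]

/-- The area of the intersection of two rectangles. -/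
def Rect.overlap (R Q : Rect) : ℝ := ∫ p, R.ind p * Q.ind p

/-- The left side is the length of an intersection of intervals; the right side is the second
difference of min that the covariance of the sheet produces. -/
lemma min_sub_min_eq_max {a b c d : ℝ} (hab : a ≤ b) (hcd : c ≤ d) :
    max (min b d - max a c) 0 = min b d - min a d - min b c + min a c := by
  simp only [max_def, min_def]
  split_ifs <;> linarith

lemma Rect.overlap_eq (R Q : Rect) :
    R.overlap Q =
      (min (R.b : ℝ) Q.b - min (R.a : ℝ) Q.b - min (R.b : ℝ) Q.a + min (R.a : ℝ) Q.a) *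
        (min (R.d : ℝ) Q.d - min (R.c : ℝ) Q.d - min (R.d : ℝ) Q.c + min (R.c : ℝ) Q.c) := by
  simp_rw [Rect.overlap, Rect.ind_mul_ind]
  rw [integral_indicator_const _ (R.measurableSet_toSet.inter Q.measurableSet_toSet), Rect.toSet,
    Rect.toSet, Set.prod_inter_prod, Set.Ioc_inter_Ioc, Set.Ioc_inter_Ioc, measureReal_def,
    Measure.volume_eq_prod, Measure.prod_prod, ENNReal.toReal_mul, Real.volume_Ioc, Real.volume_Ioc,
    ENNReal.toReal_ofReal', ENNReal.toReal_ofReal', smul_eq_mul, mul_one,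
    min_sub_min_eq_max (NNReal.coe_le_coe.2 R.hab) (NNReal.coe_le_coe.2 Q.hab),
    min_sub_min_eq_max (NNReal.coe_le_coe.2 R.hcd) (NNReal.coe_le_coe.2 Q.hcd)]

lemma IsBrownianSheet.integral_increment_mul (hB : IsBrownianSheet B P) (R Q : Rect) :
    ∫ ω, R.increment B ω * Q.increment B ω ∂P = R.overlap Q := by
  have h : ∀ p, B p ∈ linearSpan B := fun p => Submodule.subset_span ⟨p, rfl⟩
  have hi : ∀ p q, Integrable (fun ω => B p ω * B q ω) P := fun p q =>
    integrable_mul_of_memLp_two (hB.memLp (h p) (by simp)) (hB.memLp (h q) (by simp))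
  have e : ∀ ω, R.increment B ω * Q.increment B ω = ∑ i, ∑ j, (cornerSign i * cornerSign j) *
      (B (R.corner i) ω * B (Q.corner j) ω) := by
    intro ω
    rw [Rect.increment_eq_sum, Rect.increment_eq_sum, Finset.sum_mul_sum]
    exact Finset.sum_congr rfl fun i _ => Finset.sum_congr rfl fun j _ => by ring
  simp_rw [e]
  rw [integral_finsetSum _ fun i _ => integrable_finsetSum _ fun j _ => (hi _ _).const_mul _]
  simp_rw [integral_finsetSum _ fun j _ => (hi _ (Rect.corner Q j)).const_mul _,
    integral_const_mul, hB.covariance_eq, Rect.overlap_eq]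
  simp [Fin.sum_univ_four, cornerSign, Rect.corner]
  ring

lemma Rect.overlap_eq_zero {R Q : Rect} (h : Disjoint R.toSet Q.toSet) : R.overlap Q = 0 := by
  simp [Rect.overlap, Rect.ind_mul_ind, Set.disjoint_iff_inter_eq_empty.1 h]

lemma Elementary.toFun_eq (F : Elementary) (z : (ℝ × ℝ) × (ℝ × ℝ)) :
    F.toFun z = ∑ k, F.coef k * ((F.left k).ind z.1 * (F.right k).ind z.2) := by
  refine Finset.sum_congr rfl fun k _ => ?_
  congr 1
  by_cases h1 : z.1 ∈ (F.left k).toSet <;> by_cases h2 : z.2 ∈ (F.right k).toSet <;>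
    simp [Rect.ind, h1, h2, Set.indicator, Set.mem_prod]

lemma Elementary.memLp_toFun (F : Elementary) (p : ℝ≥0∞) : MemLp F.toFun p volume := by
  have : F.toFun = fun z => ∑ k, (F.coef k *
      ((F.left k).toSet ×ˢ (F.right k).toSet).indicator (fun _ => (1 : ℝ)) z) := rfl
  rw [this]
  refine memLp_finsetSum _ fun k _ => (memLp_indicator_const p
    ((F.left k).measurableSet_toSet.prod (F.right k).measurableSet_toSet) 1 (Or.inr ?_)).const_mul _
  rw [Measure.volume_eq_prod, Measure.prod_prod]
  exact (ENNReal.mul_lt_top (Rect.volume_toSet_lt_top _) (Rect.volume_toSet_lt_top _)).ne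

lemma Rect.integral_ind_mul (R R' Q Q' : Rect) :
    Integrable (fun z : (ℝ × ℝ) × (ℝ × ℝ) => (R.ind z.1 * Q.ind z.1) * (R'.ind z.2 * Q'.ind z.2)) ∧
    ∫ z : (ℝ × ℝ) × (ℝ × ℝ), (R.ind z.1 * Q.ind z.1) * (R'.ind z.2 * Q'.ind z.2) =
      R.overlap Q * R'.overlap Q' := by
  have hi : ∀ R Q : Rect, Integrable (fun p => R.ind p * Q.ind p) := by
    intro R Q
    simp_rw [Rect.ind_mul_ind]
    refine (integrable_indicator_iff (R.measurableSet_toSet.inter Q.measurableSet_toSet)).2 ?_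
    exact integrableOn_const ((measure_mono Set.inter_subset_left).trans_lt
      R.volume_toSet_lt_top).ne
  exact ⟨(hi R Q).mul_prod (hi R' Q'), integral_prod_mul (fun p => R.ind p * Q.ind p)
    (fun p => R'.ind p * Q'.ind p)⟩

/-- Isserlis' formula gives three pairings for each pair of terms: left-left with right-right yields
the first integral, left-right crosswise yields the swapped one, and the pairing within a term is
zero. -/
lemma IsBrownianSheet.integral_sq_elementary (hB : IsBrownianSheet B P) (F : Elementary) :
    ∫ ω, F.integral B ω * F.integral B ω ∂P =
      (∫ z, F.toFun z * F.toFun z) + ∫ z, F.toFun z * F.toFun z.swap := by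
  have e1 : ∀ ω, F.integral B ω * F.integral B ω = ∑ k, ∑ l, (F.coef k * F.coef l) *
      (((F.left k).increment B ω * (F.right k).increment B ω) *
        ((F.left l).increment B ω * (F.right l).increment B ω)) := by
    intro ω
    rw [Elementary.integral, Finset.sum_mul_sum]
    exact Finset.sum_congr rfl fun i _ => Finset.sum_congr rfl fun j _ => by ring
  have e2 : ∀ z, F.toFun z * F.toFun z = ∑ k, ∑ l, (F.coef k * F.coef l) *
      (((F.left k).ind z.1 * (F.left l).ind z.1) * ((F.right k).ind z.2 * (F.right l).ind z.2)) := by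
    intro z
    rw [Elementary.toFun_eq, Finset.sum_mul_sum]
    exact Finset.sum_congr rfl fun i _ => Finset.sum_congr rfl fun j _ => by ring
  have e3 : ∀ z, F.toFun z * F.toFun z.swap = ∑ k, ∑ l, (F.coef k * F.coef l) *
      (((F.left k).ind z.1 * (F.right l).ind z.1) * ((F.right k).ind z.2 * (F.left l).ind z.2)) := by
    intro z
    rw [Elementary.toFun_eq, Elementary.toFun_eq, Finset.sum_mul_sum]
    exact Finset.sum_congr rfl fun i _ => Finset.sum_congr rfl fun j _ => by
      simp only [Prod.fst_swap, Prod.snd_swap]; ring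
  have hi : ∀ k l, Integrable (fun ω => ((F.left k).increment B ω * (F.right k).increment B ω) *
        ((F.left l).increment B ω * (F.right l).increment B ω)) P := fun k l =>
    integrable_mul_of_memLp_two (hB.memLp_mul (Rect.increment_mem _) (Rect.increment_mem _))
      (hB.memLp_mul (Rect.increment_mem _) (Rect.increment_mem _))
  simp_rw [e1, e2, e3]
  rw [integral_finsetSum _ fun i _ => integrable_finsetSum _ fun j _ => (hi _ _).const_mul _,
    integral_finsetSum _ fun i _ => integrable_finsetSum _ fun j _ =>
      (Rect.integral_ind_mul _ _ _ _).1.const_mul _,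
    integral_finsetSum _ fun i _ => integrable_finsetSum _ fun j _ =>
      (Rect.integral_ind_mul _ _ _ _).1.const_mul _, ← Finset.sum_add_distrib]
  refine Finset.sum_congr rfl fun k _ => ?_
  rw [integral_finsetSum _ fun j _ => (hi _ _).const_mul _,
    integral_finsetSum _ fun j _ => (Rect.integral_ind_mul _ _ _ _).1.const_mul _,
    integral_finsetSum _ fun j _ => (Rect.integral_ind_mul _ _ _ _).1.const_mul _,
    ← Finset.sum_add_distrib]
  refine Finset.sum_congr rfl fun l _ => ?_
  rw [integral_const_mul, integral_const_mul, integral_const_mul, (Rect.integral_ind_mul _ _ _ _).2,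
    (Rect.integral_ind_mul _ _ _ _).2, hB.integral_mul_four (Rect.increment_mem _)
    (Rect.increment_mem _) (Rect.increment_mem _) (Rect.increment_mem _)]
  -- Here disjointness from the diagonal kills the pairing that would otherwise contribute a trace.
  simp only [hB.integral_increment_mul, Rect.overlap_eq_zero (F.disjoint k)]
  ring

lemma IsBrownianSheet.memLp_elementary (hB : IsBrownianSheet B P) (F : Elementary) :
    MemLp (F.integral B) 2 P := by
  refine memLp_finsetSum _ fun k _ => ?_
  have := (hB.memLp_mul (Rect.increment_mem (F.left k)) (Rect.increment_mem (F.right k))).const_mul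
    (F.coef k)
  simpa only [mul_assoc] using this

/-! ## The isometry for double Wiener integrals -/

lemma inner_toLp {α : Type*} [MeasurableSpace α] {μ : Measure α} {x y : α → ℝ}
    (hx : MemLp x 2 μ) (hy : MemLp y 2 μ) :
    inner ℝ (hx.toLp x) (hy.toLp y) = ∫ z, x z * y z ∂μ := by
  rw [L2.inner_def]
  refine integral_congr_ae ?_
  filter_upwards [hx.coeFn_toLp, hy.coeFn_toLp] with z h1 h2
  rw [h1, h2]
  simp [mul_comm]

lemma tendsto_integral_mul {α : Type*} [MeasurableSpace α] {μ : Measure α} {f g : ℕ → α → ℝ}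
    {f₀ g₀ : α → ℝ} (hf : ∀ n, MemLp (f n) 2 μ) (hg : ∀ n, MemLp (g n) 2 μ) (hf₀ : MemLp f₀ 2 μ)
    (hg₀ : MemLp g₀ 2 μ) (h1 : Tendsto (fun n => eLpNorm (fun z => f n z - f₀ z) 2 μ) atTop (𝓝 0))
    (h2 : Tendsto (fun n => eLpNorm (fun z => g n z - g₀ z) 2 μ) atTop (𝓝 0)) :
    Tendsto (fun n => ∫ z, f n z * g n z ∂μ) atTop (𝓝 (∫ z, f₀ z * g₀ z ∂μ)) := by
  have t1 := (Lp.tendsto_Lp_iff_tendsto_eLpNorm'' f hf f₀ hf₀).2 h1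
  have t2 := (Lp.tendsto_Lp_iff_tendsto_eLpNorm'' g hg g₀ hg₀).2 h2
  have := t1.inner (𝕜 := ℝ) t2
  simpa only [inner_toLp] using this

lemma IsDoubleWienerIntegral.sub (hB : IsBrownianSheet B P) {g h : (ℝ × ℝ) × (ℝ × ℝ) → ℝ}
    {X Y : Ω → ℝ} (hg : MemLp g 2 volume) (hh : MemLp h 2 volume)
    (hX : IsDoubleWienerIntegral B P g X) (hY : IsDoubleWienerIntegral B P h Y) :
    IsDoubleWienerIntegral B P (fun z => g z - h z) (fun ω => X ω - Y ω) := by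
  obtain ⟨mX, F, F1, F2⟩ := hX
  obtain ⟨mY, G, G1, G2⟩ := hY
  refine ⟨mX.sub mY, fun n => (F n).add ((G n).smul (-1)), ?_, ?_⟩
  · refine tendsto_of_tendsto_of_tendsto_of_le_of_le tendsto_const_nhds
      (by simpa using F1.add G1) (fun _ => zero_le) fun n => ?_
    have := eLpNorm_sub_le (((F n).memLp_toFun 2).sub hg).aestronglyMeasurable
      (((G n).memLp_toFun 2).sub hh).aestronglyMeasurable (p := 2) (by norm_num)
    refine le_trans (le_of_eq ?_) this
    congr 1
    funext z
    simp [Elementary.toFun_add, Elementary.toFun_smul]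
    ring
  · refine tendsto_of_tendsto_of_tendsto_of_le_of_le tendsto_const_nhds
      (by simpa using F2.add G2) (fun _ => zero_le) fun n => ?_
    have := eLpNorm_sub_le ((hB.memLp_elementary (F n)).sub mX).aestronglyMeasurable
      ((hB.memLp_elementary (G n)).sub mY).aestronglyMeasurable (p := 2) (by norm_num)
    refine le_trans (le_of_eq ?_) this
    congr 1
    funext z
    simp [Elementary.integral_add, Elementary.integral_smul]
    ring

/-- Both sides are continuous in L², and the swap preserves Lebesgue measure, so the elementary
identity passes to the limit. It holds for every version X. -/
lemma IsDoubleWienerIntegral.integral_sq (hB : IsBrownianSheet B P)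
    {g : (ℝ × ℝ) × (ℝ × ℝ) → ℝ} {X : Ω → ℝ} (hg : MemLp g 2 volume)
    (hX : IsDoubleWienerIntegral B P g X) :
    ∫ ω, X ω ^ 2 ∂P = (∫ z, g z ^ 2) + ∫ z, g z * g z.swap := by
  obtain ⟨mX, F, F1, F2⟩ := hX
  have mp : MeasurePreserving (Prod.swap : (ℝ × ℝ) × (ℝ × ℝ) → _) volume volume :=
    Measure.measurePreserving_swap
  have F1' : Tendsto (fun n => eLpNorm (fun z : (ℝ × ℝ) × (ℝ × ℝ) =>
      (F n).toFun z.swap - g z.swap) 2 volume)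
      atTop (𝓝 0) := by
    refine F1.congr fun n => ?_
    exact (eLpNorm_comp_measurePreserving
      (((F n).memLp_toFun 2).sub hg).aestronglyMeasurable mp).symm
  have t1 := tendsto_integral_mul (fun n => hB.memLp_elementary (F n))
    (fun n => hB.memLp_elementary (F n)) mX mX F2 F2
  have t2 := tendsto_integral_mul (fun n => (F n).memLp_toFun 2) (fun n => (F n).memLp_toFun 2)
    hg hg F1 F1
  have t3 := tendsto_integral_mul (fun n => (F n).memLp_toFun 2)
    (fun n => ((F n).memLp_toFun 2).comp_measurePreserving mp) hg (hg.comp_measurePreserving mp)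
    F1 F1'
  simp only [hB.integral_sq_elementary] at t1
  have := tendsto_nhds_unique t1 (t2.add t3)
  simpa only [sq, Function.comp_apply] using this

end

section

/-! ## Density of the elementary integrands -/

/-- The open quadrant, squared. -/
def quadrantSq : Set ((ℝ × ℝ) × (ℝ × ℝ)) :=
  (Set.Ioi 0 ×ˢ Set.Ioi 0) ×ˢ (Set.Ioi 0 ×ˢ Set.Ioi 0)

lemma measurableSet_quadrantSq : MeasurableSet quadrantSq :=
  (measurableSet_Ioi.prod measurableSet_Ioi).prod (measurableSet_Ioi.prod measurableSet_Ioi)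

lemma Rect.toSet_subset (R : Rect) : R.toSet ⊆ Set.Ioi 0 ×ˢ Set.Ioi 0 := fun _ hp =>
  ⟨R.a.2.trans_lt hp.1.1, R.c.2.trans_lt hp.2.1⟩

lemma Elementary.toFun_eq_zero (F : Elementary) {z : (ℝ × ℝ) × (ℝ × ℝ)} (hz : z ∉ quadrantSq) :
    F.toFun z = 0 := by
  refine Finset.sum_eq_zero fun k _ => ?_
  rw [Set.indicator_of_notMem, mul_zero]
  exact fun h => hz ⟨(F.left k).toSet_subset h.1, (F.right k).toSet_subset h.2⟩

/-- The elementary integrand with a single term. -/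
def Elementary.single (R Q : Rect) (h : Disjoint R.toSet Q.toSet) : Elementary where
  n := 1
  coef _ := 1
  left _ := R
  right _ := Q
  disjoint _ := h

lemma Elementary.toFun_single (R Q : Rect) (h : Disjoint R.toSet Q.toSet)
    (z : (ℝ × ℝ) × (ℝ × ℝ)) :
    (Elementary.single R Q h).toFun z = (R.toSet ×ˢ Q.toSet).indicator (fun _ => (1 : ℝ)) z := by
  refine (Fin.sum_univ_one _).trans ?_
  simp [Elementary.single]

/-- Balls of the product metric are squares, and half-open and closed sides differ by null sets. The
bounds on r keep the corners in the quadrant. -/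
lemma exists_rect_ae_eq_closedBall {p : ℝ × ℝ} {r : ℝ} (hr : 0 ≤ r) (h1 : r ≤ p.1)
    (h2 : r ≤ p.2) : ∃ R : Rect, R.toSet ⊆ Metric.closedBall p r ∧
      R.toSet =ᵐ[volume] Metric.closedBall p r := by
  refine ⟨⟨(p.1 - r).toNNReal, (p.1 + r).toNNReal, (p.2 - r).toNNReal, (p.2 + r).toNNReal,
    Real.toNNReal_le_toNNReal (by linarith), Real.toNNReal_le_toNNReal (by linarith)⟩, ?_⟩
  have e : Metric.closedBall p r =
      Set.Icc (p.1 - r) (p.1 + r) ×ˢ Set.Icc (p.2 - r) (p.2 + r) := by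
    rw [← Real.closedBall_eq_Icc, ← Real.closedBall_eq_Icc, closedBall_prod_same]
  rw [e, Rect.toSet]
  simp only [Real.coe_toNNReal _ (sub_nonneg.2 h1), Real.coe_toNNReal _ (sub_nonneg.2 h2),
    Real.coe_toNNReal _ (show 0 ≤ p.1 + r by linarith),
    Real.coe_toNNReal _ (show 0 ≤ p.2 + r by linarith)]
  exact ⟨Set.prod_mono Set.Ioc_subset_Icc_self Set.Ioc_subset_Icc_self,
    Measure.set_prod_ae_eq Ioc_ae_eq_Icc Ioc_ae_eq_Icc⟩

lemma ae_fst_ne_snd : ∀ᵐ z : (ℝ × ℝ) × (ℝ × ℝ), z.1 ≠ z.2 := by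
  have : volume {z : (ℝ × ℝ) × (ℝ × ℝ) | z.1 = z.2} = 0 := by
    rw [Measure.volume_eq_prod, Measure.measure_prod_null
      (measurableSet_eq_fun measurable_fst measurable_snd)]
    refine ae_of_all _ fun p => ?_
    have : Prod.mk p ⁻¹' {q : (ℝ × ℝ) × (ℝ × ℝ) | q.1 = q.2} = {p} := by
      ext q; simp [eq_comm]
    change volume (Prod.mk p ⁻¹' {q : (ℝ × ℝ) × (ℝ × ℝ) | q.1 = q.2}) = 0
    rw [this]
    simp
  exact measure_eq_zero_iff_ae_notMem.1 this

/-- At almost every point, h is the limit of its averages over small balls. Off the diagonal such a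
ball is a product of two disjoint squares, hence an elementary integrand, and the average is zero.
-/
lemma ae_eq_zero_of_integral_mul_elementary {h : (ℝ × ℝ) × (ℝ × ℝ) → ℝ}
    (hh : MemLp h 2 (volume.restrict quadrantSq))
    (h0 : ∀ F : Elementary, ∫ z in quadrantSq, h z * F.toFun z = 0) :
    h =ᵐ[volume.restrict quadrantSq] 0 := by
  rw [Filter.EventuallyEq, ae_restrict_iff' measurableSet_quadrantSq]
  set f := quadrantSq.indicator h with hf
  have hloc : LocallyIntegrable f volume :=
    ((memLp_indicator_iff_restrict measurableSet_quadrantSq).2 hh).locallyIntegrable (by norm_num)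
  filter_upwards [IsUnifLocDoublingMeasure.ae_tendsto_average volume hloc 1, ae_fst_ne_snd]
    with z hz hne hq
  have hlim := hz (ι := ℝ) (l := 𝓝[>] 0) (fun _ => z) id tendsto_id (by
    filter_upwards [self_mem_nhdsWithin] with r hr
    simpa using (Set.mem_Ioi.1 hr).le)
  have hzero : ∀ᶠ r in 𝓝[>] (0 : ℝ), ⨍ y in Metric.closedBall z r, f y = 0 := by
    obtain ⟨⟨hq1, hq2⟩, hq3, hq4⟩ := hq
    -- Below this radius the two squares are disjoint; the four coordinates bound the radius so that
    -- both squares stay in the quadrant.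
    have hd : 0 < dist z.1 z.2 / 2 := half_pos (dist_pos.2 hne)
    filter_upwards [Ioo_mem_nhdsGT hd, Ioo_mem_nhdsGT hq1, Ioo_mem_nhdsGT hq2,
      Ioo_mem_nhdsGT hq3, Ioo_mem_nhdsGT hq4] with r r0 r1 r2 r3 r4
    obtain ⟨R, hR, hR'⟩ := exists_rect_ae_eq_closedBall r0.1.le r1.2.le r2.2.le
    obtain ⟨Q, hQ, hQ'⟩ := exists_rect_ae_eq_closedBall r0.1.le r3.2.le r4.2.le
    have hdisj : Disjoint R.toSet Q.toSet :=
      (Metric.closedBall_disjoint_closedBall (by linarith [r0.2])).mono hR hQ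
    rw [setAverage_eq, ← closedBall_prod_same,
      ← setIntegral_congr_set (μ := volume) (Measure.set_prod_ae_eq hR' hQ')]
    have := h0 (Elementary.single R Q hdisj)
    simp_rw [Elementary.toFun_single] at this
    have e : ∀ y, h y * (R.toSet ×ˢ Q.toSet).indicator (fun _ => (1 : ℝ)) y =
        (R.toSet ×ˢ Q.toSet).indicator h y := fun y => by
      by_cases hy : y ∈ R.toSet ×ˢ Q.toSet <;> simp [hy]
    simp_rw [e] at this
    rw [setIntegral_indicator (R.measurableSet_toSet.prod Q.measurableSet_toSet)] at this
    rw [hf, setIntegral_indicator measurableSet_quadrantSq, Set.inter_comm, this, smul_zero]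
  have := tendsto_nhds_unique hlim ((tendsto_congr' hzero).2 tendsto_const_nhds)
  rwa [hf, Set.indicator_of_mem hq] at this

/-- The elementary integrands as a subspace of `L²`. -/
def elementarySubmodule : Submodule ℝ (Lp ℝ 2 (volume.restrict quadrantSq)) where
  carrier := {f | ∃ F : Elementary, f =ᵐ[volume.restrict quadrantSq] F.toFun}
  add_mem' := by
    rintro f g ⟨F, hF⟩ ⟨G, hG⟩
    refine ⟨F.add G, ?_⟩
    filter_upwards [Lp.coeFn_add f g, hF, hG] with z h1 h2 h3
    rw [h1, Pi.add_apply, h2, h3, Elementary.toFun_add]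
  zero_mem' := by
    refine ⟨⟨0, Fin.elim0, Fin.elim0, Fin.elim0, fun k => k.elim0⟩, ?_⟩
    filter_upwards [Lp.coeFn_zero ℝ 2 (volume.restrict quadrantSq)] with z h1
    rw [h1]
    simp [Elementary.toFun]
  smul_mem' := by
    rintro a f ⟨F, hF⟩
    refine ⟨F.smul a, ?_⟩
    filter_upwards [Lp.coeFn_smul a f, hF] with z h1 h2
    rw [h1, Pi.smul_apply, h2, Elementary.toFun_smul, smul_eq_mul]

lemma topologicalClosure_elementarySubmodule : elementarySubmodule.topologicalClosure = ⊤ := by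
  rw [Submodule.topologicalClosure_eq_top_iff, Submodule.eq_bot_iff]
  intro h hh
  rw [Lp.eq_zero_iff_ae_eq_zero]
  refine ae_eq_zero_of_integral_mul_elementary (Lp.memLp h) fun F => ?_
  have hF : MemLp F.toFun 2 (volume.restrict quadrantSq) := (F.memLp_toFun 2).restrict _
  have := (Submodule.mem_orthogonal' _ _).1 hh (hF.toLp _) ⟨F, hF.coeFn_toLp⟩
  rw [← inner_toLp (Lp.memLp h) hF, Lp.toLp_coeFn]
  exact this

lemma exists_elementary_tendsto {g : (ℝ × ℝ) × (ℝ × ℝ) → ℝ} (hg : MemLp g 2 volume)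
    (hg0 : ∀ᵐ z, z ∉ quadrantSq → g z = 0) : ∃ F : ℕ → Elementary,
      Tendsto (fun n => eLpNorm (fun z => (F n).toFun z - g z) 2 volume) atTop (𝓝 0) := by
  have hg' : MemLp g 2 (volume.restrict quadrantSq) := hg.restrict _
  have hmem : hg'.toLp g ∈ elementarySubmodule.topologicalClosure := by
    rw [topologicalClosure_elementarySubmodule]; trivial
  obtain ⟨f, hf, hlim⟩ := mem_closure_iff_seq_limit.1 hmem
  choose F hF using hf
  refine ⟨F, ?_⟩
  have hF' : ∀ n, MemLp (F n).toFun 2 (volume.restrict quadrantSq) := fun n =>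
    ((F n).memLp_toFun 2).restrict _
  have hfF : ∀ n, f n = (hF' n).toLp _ := fun n =>
    Lp.ext ((hF n).trans (hF' n).coeFn_toLp.symm)
  rw [funext hfF] at hlim
  refine ((Lp.tendsto_Lp_iff_tendsto_eLpNorm'' _ hF' g hg').1 hlim).congr fun n => ?_
  rw [← eLpNorm_indicator_eq_eLpNorm_restrict measurableSet_quadrantSq]
  refine eLpNorm_congr_ae ?_
  filter_upwards [hg0] with z hz
  by_cases h : z ∈ quadrantSq
  · simp [h]
  · simp [h, hz h, (F n).toFun_eq_zero h]

/-! ### Existence of the double Wiener integral -/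

variable {Ω : Type*} [MeasurableSpace Ω] {P : Measure Ω} {B : ℝ≥0 × ℝ≥0 → Ω → ℝ}

/-- Cauchy–Schwarz on the swapped term bounds the square by 2‖F‖². The cruder constant 2 suffices,
since only Cauchy sequences have to be transported. -/
lemma IsBrownianSheet.norm_elementary_le (hB : IsBrownianSheet B P) (F : Elementary) :
    ‖(hB.memLp_elementary F).toLp _‖ ≤ 2 * ‖(F.memLp_toFun 2).toLp _‖ := by
  have mp : MeasurePreserving (Prod.swap : (ℝ × ℝ) × (ℝ × ℝ) → _) volume volume :=
    Measure.measurePreserving_swap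
  have hs := (F.memLp_toFun 2).comp_measurePreserving mp
  have h1 := hB.integral_sq_elementary F
  have h2 := inner_toLp (F.memLp_toFun 2) hs
  simp only [Function.comp_apply] at h2
  rw [← inner_toLp (hB.memLp_elementary F) (hB.memLp_elementary F),
    ← inner_toLp (F.memLp_toFun 2) (F.memLp_toFun 2), ← h2, real_inner_self_eq_norm_sq,
    real_inner_self_eq_norm_sq] at h1
  have h3 := real_inner_le_norm ((F.memLp_toFun 2).toLp _) (hs.toLp _)
  have h4 : ‖hs.toLp _‖ = ‖(F.memLp_toFun 2).toLp _‖ := by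
    rw [Lp.norm_toLp, Lp.norm_toLp,
      eLpNorm_comp_measurePreserving (F.memLp_toFun 2).aestronglyMeasurable mp]
  rw [h4] at h3
  refine abs_le_of_sq_le_sq' ?_ (by positivity) |>.2
  nlinarith [norm_nonneg ((F.memLp_toFun 2).toLp _)]

lemma IsBrownianSheet.exists_isDoubleWienerIntegral (hB : IsBrownianSheet B P)
    {g : (ℝ × ℝ) × (ℝ × ℝ) → ℝ} (hg : MemLp g 2 volume)
    (hg0 : ∀ᵐ z, z ∉ quadrantSq → g z = 0) : ∃ X, IsDoubleWienerIntegral B P g X := by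
  obtain ⟨F, hF⟩ := exists_elementary_tendsto hg hg0
  have t1 := ((Lp.tendsto_Lp_iff_tendsto_eLpNorm'' _ (fun n => (F n).memLp_toFun 2) g hg).2 hF)
  have hle : ∀ m n, dist ((hB.memLp_elementary (F m)).toLp _) ((hB.memLp_elementary (F n)).toLp _) ≤
      2 * dist (((F m).memLp_toFun 2).toLp _) (((F n).memLp_toFun 2).toLp _) := by
    intro m n
    rw [dist_eq_norm, dist_eq_norm, ← MemLp.toLp_sub, ← MemLp.toLp_sub]
    refine le_trans (le_of_eq ?_) ((hB.norm_elementary_le ((F m).add ((F n).smul (-1)))).trans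
      (le_of_eq ?_))
    · congr 2
      funext ω
      simp [Elementary.integral_add, Elementary.integral_smul]
      ring
    · congr 3
      funext ω
      simp [Elementary.toFun_add, Elementary.toFun_smul]
      ring
  have hc : CauchySeq fun n => (hB.memLp_elementary (F n)).toLp _ := by
    rw [Metric.cauchySeq_iff]
    intro ε hε
    obtain ⟨N, hN⟩ := Metric.cauchySeq_iff.1 t1.cauchySeq (ε / 2) (half_pos hε)
    exact ⟨N, fun m hm n hn => (hle m n).trans_lt (by linarith [hN m hm n hn])⟩
  obtain ⟨X, hX⟩ := cauchySeq_tendsto_of_complete hc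
  refine ⟨X, Lp.memLp X, F, hF, ?_⟩
  refine (Lp.tendsto_Lp_iff_tendsto_eLpNorm'' _ (fun n => hB.memLp_elementary (F n)) X
    (Lp.memLp X)).1 ?_
  rwa [Lp.toLp_coeFn]

/-- The isometry for the difference of two double Wiener integrals with symmetric integrands. -/
theorem IsBrownianSheet.integral_sub_sq (hB : IsBrownianSheet B P)
    {g h : (ℝ × ℝ) × (ℝ × ℝ) → ℝ} (hg : MemLp g 2 volume) (hh : MemLp h 2 volume)
    (hg0 : ∀ᵐ z, z ∉ quadrantSq → g z = 0) (hh0 : ∀ᵐ z, z ∉ quadrantSq → h z = 0)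
    (hgs : ∀ z, g z.swap = g z) (hhs : ∀ z, h z.swap = h z) :
    ∫ ω, (doubleWienerIntegral B P g ω - doubleWienerIntegral B P h ω) ^ 2 ∂P =
      2 * ∫ z, (g z - h z) ^ 2 := by
  -- Existence ensures that the definition selects a true integral and not its default 0.
  have hX : IsDoubleWienerIntegral B P g (doubleWienerIntegral B P g) := by
    have := hB.exists_isDoubleWienerIntegral hg hg0
    rw [doubleWienerIntegral, dif_pos this]
    exact this.choose_spec
  have hY : IsDoubleWienerIntegral B P h (doubleWienerIntegral B P h) := by
    have := hB.exists_isDoubleWienerIntegral hh hh0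
    rw [doubleWienerIntegral, dif_pos this]
    exact this.choose_spec
  rw [(hX.sub hB hg hh hY).integral_sq hB (hg.sub hh)]
  simp only [Pi.sub_apply, hgs, hhs, sq]
  ring

end

section

/-! ## One-dimensional integrals -/

/-- This is the total mass of the beta distribution, cleared of its normalization. -/
lemma lintegral_beta {a b : ℝ} (ha : 0 < a) (hb : 0 < b) :
    ∫⁻ r in Set.Ioo (0 : ℝ) 1, ENNReal.ofReal (r ^ (a - 1) * (1 - r) ^ (b - 1)) =
      ENNReal.ofReal (beta a b) := by
  have h := lintegral_betaPDF_eq_one ha hb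
  have hp := beta_pos ha hb
  rw [lintegral_betaPDF] at h
  have e : ∀ r : ℝ, ENNReal.ofReal (1 / beta a b * r ^ (a - 1) * (1 - r) ^ (b - 1)) =
      ENNReal.ofReal (1 / beta a b) * ENNReal.ofReal (r ^ (a - 1) * (1 - r) ^ (b - 1)) := fun r => by
    rw [mul_assoc, ENNReal.ofReal_mul (by positivity)]
  simp_rw [e] at h
  rw [lintegral_const_mul _ (by fun_prop)] at h
  calc _ = ENNReal.ofReal (beta a b) * (ENNReal.ofReal (1 / beta a b) * _) := by
        rw [← mul_assoc, ← ENNReal.ofReal_mul hp.le, mul_one_div_cancel hp.ne',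
          ENNReal.ofReal_one, one_mul]
    _ = _ := by rw [h, mul_one]

lemma lintegral_rpow_Ioo {t q : ℝ} (ht : 0 ≤ t) (hq : -1 < q) :
    ∫⁻ x in Set.Ioo 0 t, ENNReal.ofReal (x ^ q) = ENNReal.ofReal (t ^ (q + 1) / (q + 1)) := by
  have hi : IntervalIntegrable (fun x : ℝ => x ^ q) volume 0 t :=
    intervalIntegral.intervalIntegrable_rpow' hq
  rw [setLIntegral_congr Ioo_ae_eq_Ioc, ← ofReal_integral_eq_lintegral_ofReal
    ((intervalIntegrable_iff_integrableOn_Ioc_of_le ht).1 hi)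
    ((ae_restrict_iff' measurableSet_Ioc).2 (ae_of_all _ fun x hx => Real.rpow_nonneg hx.1.le _)),
    ← intervalIntegral.integral_of_le ht, integral_rpow (Or.inl hq),
    Real.zero_rpow (by linarith), sub_zero]

lemma lintegral_eq_mul_lintegral_comp_mul (f : ℝ → ℝ≥0∞) {x : ℝ} (hx : 0 < x) :
    ∫⁻ y, f y = ENNReal.ofReal x * ∫⁻ r, f (x * r) := by
  have h := Real.smul_map_volume_mul_left hx.ne'
  rw [abs_of_pos hx] at h
  conv_lhs => rw [← h]
  rw [lintegral_smul_measure, smul_eq_mul]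
  congr 1
  exact lintegral_map_equiv f (Homeomorph.mulLeft₀ x hx.ne').toMeasurableEquiv

lemma setLIntegral_Ioo_eq_mul (f : ℝ → ℝ≥0∞) {x : ℝ} (hx : 0 < x) :
    ∫⁻ y in Set.Ioo 0 x, f y = ENNReal.ofReal x * ∫⁻ r in Set.Ioo 0 1, f (x * r) := by
  rw [← lintegral_indicator measurableSet_Ioo, ← lintegral_indicator measurableSet_Ioo,
    lintegral_eq_mul_lintegral_comp_mul _ hx]
  congr 2
  funext r
  have : x * r ∈ Set.Ioo 0 x ↔ r ∈ Set.Ioo (0 : ℝ) 1 := by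
    simp only [Set.mem_Ioo, mul_pos_iff_of_pos_left hx, mul_lt_iff_lt_one_right hx]
  by_cases h : r ∈ Set.Ioo (0 : ℝ) 1
  · rw [Set.indicator_of_mem h, Set.indicator_of_mem (this.2 h)]
  · rw [Set.indicator_of_notMem h, Set.indicator_of_notMem (fun h' => h (this.1 h'))]

/-- The integral of a symmetric function over a square is twice that over a triangle. -/
lemma setLIntegral_square_symm {G : ℝ → ℝ → ℝ≥0∞} (hG : Measurable (Function.uncurry G))
    (hs : ∀ x y, G x y = G y x) (t : ℝ) :
    ∫⁻ x in Set.Ioo 0 t, ∫⁻ y in Set.Ioo 0 t, G x y =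
      2 * ∫⁻ x in Set.Ioo 0 t, ∫⁻ y in Set.Ioo 0 x, G x y := by
  set D : Set (ℝ × ℝ) := {p | (0 < p.2 ∧ p.2 < p.1) ∧ p.1 < t} with hD
  have mD : MeasurableSet D :=
    ((measurableSet_lt measurable_const measurable_snd).inter
      (measurableSet_lt measurable_snd measurable_fst)).inter
      (measurableSet_lt measurable_fst measurable_const)
  -- H is G cut off to the triangle y < x. Its sum with its reflection is G on the square, apart
  -- from the diagonal.
  set H : ℝ × ℝ → ℝ≥0∞ := D.indicator (Function.uncurry G) with hH
  have mH : Measurable H := hG.indicator mD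
  have e1 : ∫⁻ x in Set.Ioo 0 t, ∫⁻ y in Set.Ioo 0 x, G x y = ∫⁻ x, ∫⁻ y, H (x, y) := by
    rw [← lintegral_indicator measurableSet_Ioo]
    refine lintegral_congr fun x => ?_
    by_cases hx : x ∈ Set.Ioo 0 t
    · rw [Set.indicator_of_mem hx, ← lintegral_indicator measurableSet_Ioo]
      refine lintegral_congr fun y => ?_
      simp only [hH, hD, Set.indicator_apply, Set.mem_ofPred_eq, Set.mem_Ioo, hx.2, and_true,
        Function.uncurry]
    · rw [Set.indicator_of_notMem hx]
      symm
      rw [lintegral_eq_zero_iff (by fun_prop)]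
      refine ae_of_all _ fun y => ?_
      simp only [hH, Pi.zero_apply]
      refine Set.indicator_of_notMem (fun h => hx ⟨h.1.1.trans h.1.2, h.2⟩) _
  have e2 : ∫⁻ x in Set.Ioo 0 t, ∫⁻ y in Set.Ioo 0 t, G x y =
      ∫⁻ x, ∫⁻ y, (H (x, y) + H (y, x)) := by
    rw [← lintegral_indicator measurableSet_Ioo]
    refine lintegral_congr fun x => ?_
    by_cases hx : x ∈ Set.Ioo 0 t
    · rw [Set.indicator_of_mem hx, ← lintegral_indicator measurableSet_Ioo]
      refine lintegral_congr_ae ?_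
      have : ∀ᵐ y : ℝ, y ≠ x := by simp [ae_iff]
      filter_upwards [this] with y hy
      simp only [hH, hD, Set.indicator_apply, Set.mem_ofPred_eq, Set.mem_Ioo, Function.uncurry]
      obtain ⟨hx1, hx2⟩ := hx
      rcases lt_or_gt_of_ne hy with h | h
      · simp [h, hx2, h.trans hx2, not_lt.2 h.le]
      · simp [h, hx1, hx1.trans h, not_lt.2 h.le, hs x y]
    · rw [Set.indicator_of_notMem hx]
      symm
      rw [lintegral_eq_zero_iff (by fun_prop)]
      refine ae_of_all _ fun y => ?_
      simp only [hH, Pi.zero_apply]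
      rw [Set.indicator_of_notMem (fun h => hx ⟨h.1.1.trans h.1.2, h.2⟩),
        Set.indicator_of_notMem (fun h => hx ⟨h.1.1, h.1.2.trans h.2⟩), add_zero]
  rw [e1, e2, two_mul]
  have e3 : ∀ x, ∫⁻ y, (H (x, y) + H (y, x)) = (∫⁻ y, H (x, y)) + ∫⁻ y, H (y, x) := fun x =>
    lintegral_add_left (by fun_prop) _
  simp_rw [e3]
  rw [lintegral_add_left (mH.lintegral_prod_right'), lintegral_lintegral_swap
    (f := fun x y => H (y, x)) (by fun_prop)]

/-- The integral of a symmetric homogeneous function over a square. -/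
lemma setLIntegral_square_homogeneous {G : ℝ → ℝ → ℝ≥0∞} (hG : Measurable (Function.uncurry G))
    (hs : ∀ x y, G x y = G y x) {q : ℝ} (hq : -2 < q)
    (hom : ∀ x r : ℝ, 0 < x → 0 < r → r < 1 → G x (x * r) = ENNReal.ofReal (x ^ q) * G 1 r)
    {t : ℝ} (ht : 0 ≤ t) :
    ∫⁻ x in Set.Ioo 0 t, ∫⁻ y in Set.Ioo 0 t, G x y =
      ENNReal.ofReal (2 * (t ^ (q + 2) / (q + 2))) * ∫⁻ r in Set.Ioo (0 : ℝ) 1, G 1 r := by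
  have mG : Measurable (G 1) := hG.comp measurable_prodMk_left
  rw [setLIntegral_square_symm hG hs]
  have e : ∀ x ∈ Set.Ioo 0 t, ∫⁻ y in Set.Ioo 0 x, G x y =
      ENNReal.ofReal (x ^ (q + 1)) * ∫⁻ r in Set.Ioo (0 : ℝ) 1, G 1 r := by
    intro x hx
    rw [setLIntegral_Ioo_eq_mul _ hx.1, setLIntegral_congr_fun measurableSet_Ioo
      (fun r hr => hom x r hx.1 hr.1 hr.2), lintegral_const_mul _ mG, ← mul_assoc,
      ← ENNReal.ofReal_mul hx.1.le, Real.rpow_add_one hx.1.ne', mul_comm x]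
  rw [setLIntegral_congr_fun measurableSet_Ioo e, lintegral_mul_const _ (by fun_prop),
    lintegral_rpow_Ioo ht (by linarith), ← mul_assoc, ENNReal.ofReal_mul (by norm_num),
    ENNReal.ofReal_ofNat, add_assoc]
  norm_num

/-! ## The kernel of the Rosenblatt process -/

/-- The unnormalized derivative `∂ₓK(x,y)` on `0 < y < x`, extended by zero. -/
def derivKernel (α x y : ℝ) : ℝ≥0∞ :=
  if 0 < y ∧ y < x then ENNReal.ofReal (y ^ (-α / 2) * (x - y) ^ (α / 2 - 1) * x ^ (α / 2)) else 0

@[fun_prop]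
lemma measurable_derivKernel (α : ℝ) : Measurable (Function.uncurry (derivKernel α)) := by
  refine Measurable.ite ?_ (by fun_prop) measurable_const
  exact (measurableSet_lt measurable_const measurable_snd).inter
    (measurableSet_lt measurable_snd measurable_fst)

/-- Applied below with a = y, b = x'-x, c = x, d = x'-y, e = x-y, f = x': Jacobian times beta
integrand on the left. In logarithms both sides are exponentials of the same linear form. -/
lemma mobius_rpow_identity {a b c d e f : ℝ} (ha : 0 < a) (hb : 0 < b) (hc : 0 < c) (hd : 0 < d)
    (he : 0 < e) (hf : 0 < f) (α : ℝ) :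
    b * f / (c * d ^ 2) * ((a * b / (c * d)) ^ (-α) * (f * e / (c * d)) ^ (α / 2 - 1)) =
      b ^ (1 - α) * ((a ^ (-α / 2) * e ^ (α / 2 - 1) * c ^ (α / 2)) *
        (a ^ (-α / 2) * d ^ (α / 2 - 1) * f ^ (α / 2))) := by
  rw [← Real.exp_log ha, ← Real.exp_log hb, ← Real.exp_log hc, ← Real.exp_log hd,
    ← Real.exp_log he, ← Real.exp_log hf]
  simp only [← Real.exp_add, ← Real.exp_sub, ← Real.exp_mul, ← Real.exp_nat_mul]
  congr 1
  push_cast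
  ring

/-- The Möbius map v(y) = y(x'-x)/(x(x'-y)) carries (0,x) onto (0,1), with 1 - v =
x'(x-y)/(x(x'-y)). It turns the product of kernels into the beta integrand with parameters 1-α and
α/2, at the price of a factor (x'-x)^{α-1}. -/
lemma lintegral_derivKernel_mul_of_lt {α : ℝ} (hα : 0 < α) (hα' : α < 1) {x x' : ℝ} (hx : 0 < x)
    (hxx' : x < x') :
    ∫⁻ y, derivKernel α x y * derivKernel α x' y =
      ENNReal.ofReal (beta (1 - α) (α / 2) * (x' - x) ^ (α - 1)) := by
  have hx' : 0 < x' := hx.trans hxx'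
  have hd : 0 < x' - x := sub_pos.2 hxx'
  set v : ℝ → ℝ := fun y => y * (x' - x) / (x * (x' - y)) with hv
  have hderiv : ∀ y ∈ Set.Ioo 0 x,
      HasDerivWithinAt v ((x' - x) * x' / (x * (x' - y) ^ 2)) (Set.Ioo 0 x) y := by
    intro y hy
    have h1 : x' - y ≠ 0 := by linarith [hy.2]
    have h2 := ((hasDerivAt_id y).mul_const (x' - x)).div
      (((hasDerivAt_id y).const_sub x').const_mul x) (mul_ne_zero hx.ne' h1)
    refine (h2.congr_deriv ?_).hasDerivWithinAt
    simp only [id]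
    field_simp
    ring
  have hinj : Set.InjOn v (Set.Ioo 0 x) := by
    intro y hy z hz h
    have h1 : x' - y ≠ 0 := by linarith [hy.2]
    have h2 : x' - z ≠ 0 := by linarith [hz.2]
    simp only [hv] at h
    rw [div_eq_div_iff (mul_ne_zero hx.ne' h1) (mul_ne_zero hx.ne' h2)] at h
    have : (x' - x) * x * x' * (y - z) = 0 := by linear_combination h
    rcases mul_eq_zero.1 this with h | h
    · exact absurd h (by positivity)
    · linarith
  have himg : v '' Set.Ioo 0 x = Set.Ioo 0 1 := by
    ext u
    constructor
    · rintro ⟨y, hy, rfl⟩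
      have h1 : 0 < x' - y := by linarith [hy.2]
      have := hy.1
      refine ⟨by positivity, ?_⟩
      simp only [hv]
      rw [div_lt_one (by positivity)]
      nlinarith [hy.2]
    · rintro ⟨h0, h1⟩
      have h2 : 0 < x' - x + u * x := by positivity
      -- The inverse Möbius map at u.
      refine ⟨u * x * x' / (x' - x + u * x), ⟨by positivity, ?_⟩, ?_⟩
      · rw [div_lt_iff₀ h2]
        nlinarith [mul_pos hx hd]
      · have h3 : x' - u * x * x' / (x' - x + u * x) = x' * (x' - x) / (x' - x + u * x) := by
          field_simp
          ring
        simp only [hv]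
        rw [h3]
        field_simp
  have key := lintegral_image_eq_lintegral_abs_deriv_mul measurableSet_Ioo hderiv hinj
    (fun r => ENNReal.ofReal (r ^ ((1 - α) - 1) * (1 - r) ^ (α / 2 - 1)))
  rw [himg, lintegral_beta (by linarith) (by linarith)] at key
  have e : ∀ y ∈ Set.Ioo 0 x, ENNReal.ofReal |(x' - x) * x' / (x * (x' - y) ^ 2)| *
      ENNReal.ofReal (v y ^ ((1 - α) - 1) * (1 - v y) ^ (α / 2 - 1)) =
      ENNReal.ofReal ((x' - x) ^ (1 - α)) * (derivKernel α x y * derivKernel α x' y) := by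
    intro y hy
    have hy0 := hy.1
    have h1 : 0 < x' - y := by linarith [hy.2]
    have h2 : 0 < x - y := by linarith [hy.2]
    have hv1 : 1 - v y = x' * (x - y) / (x * (x' - y)) := by
      simp only [hv]
      field_simp
      ring
    rw [derivKernel, if_pos ⟨hy.1, hy.2⟩, derivKernel, if_pos ⟨hy.1, hy.2.trans hxx'⟩,
      ← ENNReal.ofReal_mul (abs_nonneg _), ← ENNReal.ofReal_mul (by positivity),
      ← ENNReal.ofReal_mul (by positivity), abs_of_pos (by positivity), hv1,
      show (1 - α) - 1 = -α by ring, mobius_rpow_identity hy0 hd hx h1 h2 hx']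
  rw [setLIntegral_congr_fun measurableSet_Ioo e, lintegral_const_mul _ (by fun_prop)] at key
  have hsupp : ∫⁻ y in Set.Ioo 0 x, derivKernel α x y * derivKernel α x' y =
      ∫⁻ y, derivKernel α x y * derivKernel α x' y := by
    rw [← lintegral_indicator measurableSet_Ioo]
    refine lintegral_congr fun y => ?_
    by_cases hy : y ∈ Set.Ioo 0 x
    · rw [Set.indicator_of_mem hy]
    · rw [Set.indicator_of_notMem hy, derivKernel, if_neg (show ¬(0 < y ∧ y < x) from hy), zero_mul]
  rw [hsupp] at key
  rw [mul_comm, ENNReal.ofReal_mul (by positivity), key, ← mul_assoc,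
    ← ENNReal.ofReal_mul (by positivity), ← Real.rpow_add hd]
  simp

lemma lintegral_derivKernel_mul {α : ℝ} (hα : 0 < α) (hα' : α < 1) {x x' : ℝ} (hx : 0 < x)
    (hx' : 0 < x') (h : x ≠ x') :
    ∫⁻ y, derivKernel α x y * derivKernel α x' y =
      ENNReal.ofReal (beta (1 - α) (α / 2) * |x - x'| ^ (α - 1)) := by
  rcases lt_or_gt_of_ne h with h | h
  · rw [lintegral_derivKernel_mul_of_lt hα hα' hx h, abs_of_neg (by linarith), neg_sub]
  · simp_rw [mul_comm (derivKernel α x _)]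
    rw [lintegral_derivKernel_mul_of_lt hα hα' hx' h, abs_of_pos (by linarith)]

/-- The unnormalized kernel `∫₀ᵗ ∂ₓK(x,y₁) ∂ₓK(x,y₂) dx`. -/
def intKernel (α t : ℝ) (p : ℝ × ℝ) : ℝ≥0∞ :=
  ∫⁻ x in Set.Ioo 0 t, derivKernel α x p.1 * derivKernel α x p.2

@[fun_prop]
lemma measurable_intKernel (α t : ℝ) : Measurable (intKernel α t) :=
  Measurable.lintegral_prod_right' (f := fun z : (ℝ × ℝ) × ℝ =>
    derivKernel α z.2 z.1.1 * derivKernel α z.2 z.1.2) (by fun_prop)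

/-- Write the square as a double integral over x and x'. By Tonelli the y-integrals factor into two
equal copies, leaving the integral of |x-x'|^{2α-2} over a square, which is finite because α > 1/2.
-/
lemma lintegral_intKernel_sq {α : ℝ} (hα : 1 / 2 < α) (hα' : α < 1) {t : ℝ} (ht : 0 ≤ t) :
    ∫⁻ p, intKernel α t p * intKernel α t p =
      ENNReal.ofReal (beta (1 - α) (α / 2) ^ 2 * (t ^ (2 * α) / (α * (2 * α - 1)))) := by
  have hb : 0 < beta (1 - α) (α / 2) := beta_pos (by linarith) (by linarith)
  set μ := (volume : Measure ℝ).restrict (Set.Ioo 0 t) with hμ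
  let f : ℝ → ℝ → ℝ≥0∞ := derivKernel α
  have mf : Measurable (Function.uncurry f) := measurable_derivKernel α
  have step1 : ∀ p : ℝ × ℝ, intKernel α t p * intKernel α t p =
      ∫⁻ x, ∫⁻ x', (f x p.1 * f x' p.1) * (f x p.2 * f x' p.2) ∂μ ∂μ := by
    intro p
    rw [intKernel, ← lintegral_mul_const _ (by fun_prop)]
    refine lintegral_congr fun x => ?_
    rw [← lintegral_const_mul _ (by fun_prop)]
    refine lintegral_congr fun x' => ?_
    simp only [f]
    ring
  have mf4 : Measurable fun z : (ℝ × ℝ) × (ℝ × ℝ) =>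
      (f z.2.1 z.1.1 * f z.2.2 z.1.1) * (f z.2.1 z.1.2 * f z.2.2 z.1.2) := by
    simp only [f]; fun_prop
  have step2 : ∫⁻ p, intKernel α t p * intKernel α t p =
      ∫⁻ x, ∫⁻ x', (∫⁻ y, f x y * f x' y) * (∫⁻ y, f x y * f x' y) ∂μ ∂μ := by
    simp_rw [step1]
    have : ∀ p : ℝ × ℝ, ∫⁻ x, ∫⁻ x', (f x p.1 * f x' p.1) * (f x p.2 * f x' p.2) ∂μ ∂μ =
        ∫⁻ w, (f w.1 p.1 * f w.2 p.1) * (f w.1 p.2 * f w.2 p.2) ∂(μ.prod μ) := fun p =>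
      (lintegral_prod (fun w : ℝ × ℝ => (f w.1 p.1 * f w.2 p.1) * (f w.1 p.2 * f w.2 p.2))
        (Measurable.aemeasurable (by fun_prop))).symm
    simp_rw [this]
    rw [lintegral_lintegral_swap (f := fun (p w : ℝ × ℝ) =>
      (f w.1 p.1 * f w.2 p.1) * (f w.1 p.2 * f w.2 p.2)) mf4.aemeasurable]
    have : ∀ w : ℝ × ℝ, ∫⁻ p : ℝ × ℝ, (f w.1 p.1 * f w.2 p.1) * (f w.1 p.2 * f w.2 p.2) =
        (∫⁻ y, f w.1 y * f w.2 y) * (∫⁻ y, f w.1 y * f w.2 y) := fun w => by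
      rw [Measure.volume_eq_prod]
      exact lintegral_prod_mul (f := fun y => f w.1 y * f w.2 y) (g := fun y => f w.1 y * f w.2 y)
        (by fun_prop) (by fun_prop)
    simp_rw [this]
    have m2 : Measurable fun w : ℝ × ℝ => ∫⁻ y, f w.1 y * f w.2 y :=
      Measurable.lintegral_prod_right' (f := fun z : (ℝ × ℝ) × ℝ => f z.1.1 z.2 * f z.1.2 z.2)
        (by fun_prop)
    rw [lintegral_prod _ (by fun_prop)]
  rw [step2]
  have step3 : ∫⁻ x, ∫⁻ x', (∫⁻ y, f x y * f x' y) * (∫⁻ y, f x y * f x' y) ∂μ ∂μ =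
      ∫⁻ x in Set.Ioo 0 t, ∫⁻ x' in Set.Ioo 0 t,
        ENNReal.ofReal (beta (1 - α) (α / 2) ^ 2) * ENNReal.ofReal (|x - x'| ^ (2 * α - 2)) := by
    refine setLIntegral_congr_fun measurableSet_Ioo fun x hx => ?_
    refine lintegral_congr_ae ?_
    have : ∀ᵐ y : ℝ ∂μ, y ≠ x := ae_restrict_of_ae (by simp [ae_iff])
    filter_upwards [this, ae_restrict_mem measurableSet_Ioo] with x' hne hx'
    simp only [f]
    have hpos : 0 < |x - x'| := abs_pos.2 (sub_ne_zero.2 hne.symm)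
    rw [lintegral_derivKernel_mul (by linarith) hα' hx.1 hx'.1 hne.symm,
      ← ENNReal.ofReal_mul (by positivity), ← ENNReal.ofReal_mul (by positivity),
      show 2 * α - 2 = (α - 1) + (α - 1) by ring, Real.rpow_add hpos]
    congr 1
    ring
  have mabs : Measurable fun p : ℝ × ℝ => ENNReal.ofReal (|p.1 - p.2| ^ (2 * α - 2)) := by fun_prop
  rw [step3]
  simp_rw [lintegral_const_mul' _ _ ENNReal.ofReal_ne_top]
  rw [setLIntegral_square_homogeneous
    (G := fun x y => ENNReal.ofReal (|x - y| ^ (2 * α - 2))) (q := 2 * α - 2) mabs (fun x y => by rw [abs_sub_comm])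
    (by linarith) _ ht]
  · have e : ∀ r ∈ Set.Ioo (0 : ℝ) 1, ENNReal.ofReal (|1 - r| ^ (2 * α - 2)) =
        ENNReal.ofReal (r ^ ((1 : ℝ) - 1) * (1 - r) ^ ((2 * α - 1) - 1)) := by
      intro r hr
      rw [abs_of_pos (by linarith [hr.2]), sub_self, Real.rpow_zero, one_mul]
      ring_nf
    have hbeta : beta 1 (2 * α - 1) = 1 / (2 * α - 1) := by
      rw [beta, Real.Gamma_one, add_comm, Real.Gamma_add_one (by linarith)]
      have := Real.Gamma_pos_of_pos (show 0 < 2 * α - 1 by linarith)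
      field_simp
    have h1 : 2 * α - 1 ≠ 0 := by linarith
    have h2 : 0 < α := by linarith
    rw [setLIntegral_congr_fun measurableSet_Ioo e, lintegral_beta one_pos (by linarith), hbeta,
      show 2 * α - 2 + 2 = 2 * α by ring, ← ENNReal.ofReal_mul (by positivity),
      ← ENNReal.ofReal_mul (by positivity)]
    congr 1
    field_simp
  · intro x r hx hr hr1
    have : x - x * r = x * (1 - r) := by ring
    rw [this, abs_mul, abs_of_pos hx, Real.mul_rpow hx.le (abs_nonneg _),
      ENNReal.ofReal_mul (by positivity)]

end

section

/-! ## The approximating kernel -/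

/-- The one-parameter factor of the second kernel. -/
def secondFactor (α y₁ y₂ : ℝ) : ℝ :=
  max y₁ y₂ ^ (α / 2) * min y₁ y₂ ^ (-α / 2) * |y₁ - y₂| ^ (α - 1)

lemma secondFactor_comm (α x y : ℝ) : secondFactor α x y = secondFactor α y x := by
  rw [secondFactor, secondFactor, max_comm, min_comm, abs_sub_comm]

lemma secondFactor_nonneg (α : ℝ) {x y : ℝ} (hx : 0 ≤ x) (hy : 0 ≤ y) : 0 ≤ secondFactor α x y := by
  have : 0 ≤ min x y := le_min hx hy
  have : 0 ≤ max x y := hx.trans (le_max_left _ _)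
  unfold secondFactor
  positivity

@[fun_prop]
lemma measurable_secondFactor (α : ℝ) : Measurable (Function.uncurry (secondFactor α)) := by
  unfold secondFactor Function.uncurry
  fun_prop

lemma secondFactor_mul {α x a b : ℝ} (hx : 0 < x) (ha : 0 < a) (hb : 0 < b) :
    secondFactor α (x * a) (x * b) = x ^ (α - 1) * secondFactor α a b := by
  have h1 : x ^ (α / 2) * x ^ (-α / 2) = 1 := by
    rw [← Real.rpow_add hx]
    norm_num [neg_div]
  rw [secondFactor, secondFactor, ← mul_max_of_nonneg _ _ hx.le, ← mul_min_of_nonneg _ _ hx.le,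
    ← mul_sub, abs_mul, abs_of_pos hx, Real.mul_rpow hx.le (le_max_of_le_left ha.le),
    Real.mul_rpow hx.le (le_min ha.le hb.le), Real.mul_rpow hx.le (abs_nonneg _)]
  linear_combination (max a b ^ (α / 2) * min a b ^ (-α / 2) * |a - b| ^ (α - 1) * x ^ (α - 1)) * h1

/-- The one-parameter factor of the second kernel, restricted to a square. -/
def squareKernel (α t : ℝ) (p : ℝ × ℝ) : ℝ≥0∞ :=
  (Set.Ioo 0 t ×ˢ Set.Ioo 0 t).indicator (fun p => ENNReal.ofReal (secondFactor α p.1 p.2)) p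

@[fun_prop]
lemma measurable_squareKernel (α t : ℝ) : Measurable (squareKernel α t) :=
  ((measurable_secondFactor α).ennreal_ofReal).indicator (measurableSet_Ioo.prod measurableSet_Ioo)

lemma lintegral_indicator_square {f : ℝ × ℝ → ℝ≥0∞} (hf : Measurable f) (t : ℝ) :
    ∫⁻ p, (Set.Ioo 0 t ×ˢ Set.Ioo 0 t).indicator f p =
      ∫⁻ x in Set.Ioo 0 t, ∫⁻ y in Set.Ioo 0 t, f (x, y) := by
  rw [lintegral_indicator (measurableSet_Ioo.prod measurableSet_Ioo), Measure.volume_eq_prod,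
    ← Measure.prod_restrict, lintegral_prod _ hf.aemeasurable]

/-- The squared factor is homogeneous of degree 2α-2, and at (1,r) it equals r^{-α}(1-r)^{2α-2}, a
beta integrand. -/
lemma lintegral_squareKernel_sq {α : ℝ} (hα : 1 / 2 < α) (hα' : α < 1) {t : ℝ} (ht : 0 ≤ t) :
    ∫⁻ p, squareKernel α t p * squareKernel α t p =
      ENNReal.ofReal (beta (1 - α) (2 * α - 1) * (t ^ (2 * α) / α)) := by
  have h0 : 0 < α := by linarith
  have hb : 0 < beta (1 - α) (2 * α - 1) := beta_pos (by linarith) (by linarith)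
  set G : ℝ → ℝ → ℝ≥0∞ := fun x y =>
    ENNReal.ofReal (secondFactor α x y) * ENNReal.ofReal (secondFactor α x y) with hG
  have mG : Measurable (Function.uncurry G) := by
    simp only [hG]; fun_prop
  have e : ∀ p, squareKernel α t p * squareKernel α t p =
      (Set.Ioo 0 t ×ˢ Set.Ioo 0 t).indicator (Function.uncurry G) p := by
    intro p
    by_cases h : p ∈ Set.Ioo 0 t ×ˢ Set.Ioo 0 t
    · simp [squareKernel, h, hG, Function.uncurry]
    · simp [squareKernel, h]
  simp_rw [e]
  rw [lintegral_indicator_square mG]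
  change ∫⁻ x in Set.Ioo 0 t, ∫⁻ y in Set.Ioo 0 t, G x y = _
  rw [setLIntegral_square_homogeneous (q := 2 * α - 2) mG
    (fun x y => by simp only [hG, secondFactor_comm]) (by linarith) _ ht]
  · have e : ∀ r ∈ Set.Ioo (0 : ℝ) 1, G 1 r =
        ENNReal.ofReal (r ^ ((1 - α) - 1) * (1 - r) ^ ((2 * α - 1) - 1)) := by
      intro r hr
      have h1 : 0 < 1 - r := by linarith [hr.2]
      simp only [hG]
      rw [← ENNReal.ofReal_mul (secondFactor_nonneg α zero_le_one hr.1.le), secondFactor,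
        max_eq_left hr.2.le, min_eq_right hr.2.le, abs_of_pos h1, Real.one_rpow, one_mul,
        show (1 - α) - 1 = -α / 2 + -α / 2 by ring,
        show (2 * α - 1) - 1 = (α - 1) + (α - 1) by ring, Real.rpow_add hr.1, Real.rpow_add h1]
      congr 1
      ring
    rw [setLIntegral_congr_fun measurableSet_Ioo e, lintegral_beta (by linarith) (by linarith),
      show 2 * α - 2 + 2 = 2 * α by ring, ← ENNReal.ofReal_mul (by positivity)]
    congr 1
    field_simp
  · intro x r hx hr hr1
    have := secondFactor_mul (α := α) hx one_pos hr
    rw [mul_one] at this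
    simp only [hG]
    rw [this, ← ENNReal.ofReal_mul, ← ENNReal.ofReal_mul, ← ENNReal.ofReal_mul,
      show 2 * α - 2 = (α - 1) + (α - 1) by ring, Real.rpow_add hx]
    · congr 1
      ring
    all_goals
      have := secondFactor_nonneg α zero_le_one hr.le
      positivity

/-! ## The mixed integral -/

/-- The integrand of the constant `C₂`. -/
def crossIntegrand (α s r : ℝ) : ℝ :=
  r ^ (-α) * (1 - s) ^ (α / 2 - 1) * (1 - r) ^ (α / 2 - 1) * (s - r) ^ (α - 1)

@[fun_prop]
lemma measurable_crossIntegrand (α : ℝ) : Measurable (Function.uncurry (crossIntegrand α)) := by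
  unfold crossIntegrand Function.uncurry
  fun_prop

lemma crossIntegrand_pos {α s r : ℝ} (hr : 0 < r) (hrs : r < s) (hs : s < 1) :
    0 < crossIntegrand α s r := by
  have h1 : 0 < 1 - s := by linarith
  have h2 : 0 < 1 - r := by linarith
  have h3 : 0 < s - r := by linarith
  unfold crossIntegrand
  positivity

/-- The double integral in the constant `C₂`, as an extended nonnegative number. -/
def crossConst (α : ℝ) : ℝ≥0∞ :=
  ∫⁻ s in Set.Ioo (0 : ℝ) 1, ∫⁻ r in Set.Ioo 0 s, ENNReal.ofReal (crossIntegrand α s r)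

lemma derivKernel_mul {α x r : ℝ} (hx : 0 < x) (hr : 0 < r) (hr1 : r < 1) :
    derivKernel α x (x * r) = ENNReal.ofReal (x ^ (α / 2 - 1)) * derivKernel α 1 r := by
  have h1 : 0 < 1 - r := by linarith
  rw [derivKernel, if_pos ⟨by positivity, by nlinarith⟩, derivKernel, if_pos ⟨hr, hr1⟩,
    ← ENNReal.ofReal_mul (by positivity), show x - x * r = x * (1 - r) by ring,
    Real.mul_rpow hx.le hr.le, Real.mul_rpow hx.le h1.le, Real.one_rpow]
  congr 1
  have h2 : x ^ (-α / 2) * x ^ (α / 2) = 1 := by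
    rw [← Real.rpow_add hx]
    norm_num [neg_div]
  linear_combination (r ^ (-α / 2) * x ^ (α / 2 - 1) * (1 - r) ^ (α / 2 - 1)) * h2

/-- On the triangle b < a the powers of a cancel and those of b combine to b^{-α}, which gives the
integrand of C₂; the 2 counts the two triangles. -/
lemma lintegral_derivKernel_square_one (α : ℝ) :
    ∫⁻ a in Set.Ioo (0 : ℝ) 1, ∫⁻ b in Set.Ioo (0 : ℝ) 1,
      derivKernel α 1 a * derivKernel α 1 b * ENNReal.ofReal (secondFactor α a b) =
      2 * crossConst α := by
  rw [setLIntegral_square_symm (G := fun a b =>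
    derivKernel α 1 a * derivKernel α 1 b * ENNReal.ofReal (secondFactor α a b))
    (by fun_prop)
    (fun a b => by rw [secondFactor_comm, mul_comm (derivKernel α 1 a)])]
  congr 1
  refine setLIntegral_congr_fun measurableSet_Ioo fun a ha => ?_
  refine setLIntegral_congr_fun measurableSet_Ioo fun b hb => ?_
  have ha0 := ha.1
  have hb0 := hb.1
  have h1 : 0 < 1 - a := by linarith [ha.2]
  have h2 : 0 < 1 - b := by linarith [ha.2, hb.2]
  have h3 : 0 < a - b := by linarith [hb.2]
  rw [derivKernel, if_pos ⟨ha.1, ha.2⟩, derivKernel, if_pos ⟨hb.1, hb.2.trans ha.2⟩,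
    ← ENNReal.ofReal_mul (by positivity), ← ENNReal.ofReal_mul (by positivity), secondFactor,
    max_eq_left hb.2.le, min_eq_right hb.2.le, abs_of_pos h3, crossIntegrand, Real.one_rpow]
  congr 1
  have e1 : a ^ (-α / 2) * a ^ (α / 2) = 1 := by
    rw [← Real.rpow_add ha0]
    norm_num [neg_div]
  have e2 : b ^ (-α) = b ^ (-α / 2) * b ^ (-α / 2) := by
    rw [← Real.rpow_add hb0]
    congr 1
    ring
  rw [e2]
  linear_combination ((1 - a) ^ (α / 2 - 1) * b ^ (-α / 2) * (1 - b) ^ (α / 2 - 1) *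
    b ^ (-α / 2) * (a - b) ^ (α - 1)) * e1

/-- Rescale by x: the two derivative kernels contribute degree α/2-1 each, the second factor α-1,
and the two Jacobians 2, in total 2α-1. The cut-off at t is invisible, since the derivative kernels
already vanish beyond x. -/
lemma lintegral_derivKernel_square (α : ℝ) {t x : ℝ} (hx : 0 < x) (hxt : x < t) :
    ∫⁻ p : ℝ × ℝ, derivKernel α x p.1 * derivKernel α x p.2 * squareKernel α t p =
      ENNReal.ofReal (x ^ (2 * α - 1)) * (2 * crossConst α) := by
  have e : ∀ p : ℝ × ℝ, derivKernel α x p.1 * derivKernel α x p.2 * squareKernel α t p =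
      (Set.Ioo 0 x ×ˢ Set.Ioo 0 x).indicator (fun p =>
        derivKernel α x p.1 * derivKernel α x p.2 * ENNReal.ofReal (secondFactor α p.1 p.2)) p := by
    intro p
    by_cases h : p ∈ Set.Ioo 0 x ×ˢ Set.Ioo 0 x
    · have : p ∈ Set.Ioo 0 t ×ˢ Set.Ioo 0 t :=
        ⟨⟨h.1.1, h.1.2.trans hxt⟩, ⟨h.2.1, h.2.2.trans hxt⟩⟩
      rw [Set.indicator_of_mem h, squareKernel, Set.indicator_of_mem this]
    · rw [Set.indicator_of_notMem h]
      rw [Set.mem_prod, not_and_or] at h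
      rcases h with h | h
      · rw [derivKernel, if_neg (show ¬(0 < p.1 ∧ p.1 < x) from h), zero_mul, zero_mul]
      · rw [derivKernel, derivKernel, if_neg (show ¬(0 < p.2 ∧ p.2 < x) from h), mul_zero, zero_mul]
  simp_rw [e]
  rw [lintegral_indicator_square (by fun_prop), setLIntegral_Ioo_eq_mul _ hx]
  have e2 : ∀ a ∈ Set.Ioo (0 : ℝ) 1, ∫⁻ y in Set.Ioo 0 x, derivKernel α x (x * a) *
      derivKernel α x y * ENNReal.ofReal (secondFactor α (x * a) y) =
      ENNReal.ofReal (x ^ (2 * α - 2)) * ∫⁻ b in Set.Ioo (0 : ℝ) 1,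
        derivKernel α 1 a * derivKernel α 1 b * ENNReal.ofReal (secondFactor α a b) := by
    intro a ha
    rw [setLIntegral_Ioo_eq_mul _ hx]
    have e3 : ∀ b ∈ Set.Ioo (0 : ℝ) 1, derivKernel α x (x * a) * derivKernel α x (x * b) *
        ENNReal.ofReal (secondFactor α (x * a) (x * b)) = ENNReal.ofReal (x ^ (2 * α - 3)) *
        (derivKernel α 1 a * derivKernel α 1 b * ENNReal.ofReal (secondFactor α a b)) := by
      intro b hb
      rw [derivKernel_mul hx ha.1 ha.2, derivKernel_mul hx hb.1 hb.2,
        secondFactor_mul hx ha.1 hb.1, ENNReal.ofReal_mul (by positivity),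
        show 2 * α - 3 = (α / 2 - 1) + (α / 2 - 1) + (α - 1) by ring, Real.rpow_add hx,
        Real.rpow_add hx, ENNReal.ofReal_mul (by positivity), ENNReal.ofReal_mul (by positivity)]
      ring
    rw [setLIntegral_congr_fun measurableSet_Ioo e3, lintegral_const_mul _ (by fun_prop),
      ← mul_assoc, ← ENNReal.ofReal_mul hx.le]
    congr 2
    nth_rewrite 1 [← Real.rpow_one x]
    rw [← Real.rpow_add hx]
    congr 1
    ring
  rw [setLIntegral_congr_fun measurableSet_Ioo e2, lintegral_const_mul' _ _ ENNReal.ofReal_ne_top,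
    lintegral_derivKernel_square_one, ← mul_assoc, ← ENNReal.ofReal_mul hx.le]
  congr 2
  nth_rewrite 1 [← Real.rpow_one x]
  rw [← Real.rpow_add hx]
  congr 1
  ring

lemma lintegral_intKernel_mul {α : ℝ} (hα : 0 < α) {t : ℝ} (ht : 0 ≤ t) :
    ∫⁻ p, intKernel α t p * squareKernel α t p =
      ENNReal.ofReal (t ^ (2 * α) / α) * crossConst α := by
  have e : ∀ p, intKernel α t p * squareKernel α t p = ∫⁻ x in Set.Ioo 0 t,
      derivKernel α x p.1 * derivKernel α x p.2 * squareKernel α t p := fun p => by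
    rw [intKernel, lintegral_mul_const _ (by fun_prop)]
  simp_rw [e]
  rw [lintegral_lintegral_swap (f := fun (p : ℝ × ℝ) x =>
      derivKernel α x p.1 * derivKernel α x p.2 * squareKernel α t p)
      (Measurable.aemeasurable (by fun_prop)),
    setLIntegral_congr_fun measurableSet_Ioo
      (fun x hx => lintegral_derivKernel_square α hx.1 hx.2),
    lintegral_mul_const _ (by fun_prop), lintegral_rpow_Ioo ht (by linarith), ← mul_assoc]
  congr 1
  rw [show (2 : ℝ≥0∞) = ENNReal.ofReal 2 by simp, ← ENNReal.ofReal_mul (by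
    rw [sub_add_cancel]; positivity), sub_add_cancel]
  congr 1
  field_simp

/-- No estimate of the singularities is needed: fg ≤ f² + g² bounds the mixed integral at t = 1 by
the two known square integrals. -/
lemma crossConst_ne_top {α : ℝ} (hα : 1 / 2 < α) (hα' : α < 1) : crossConst α ≠ ∞ := by
  have h0 : 0 < α := by linarith
  have h := lintegral_intKernel_mul h0 zero_le_one
  have hle : ∫⁻ p, intKernel α 1 p * squareKernel α 1 p ≤
      (∫⁻ p, intKernel α 1 p * intKernel α 1 p) + ∫⁻ p, squareKernel α 1 p * squareKernel α 1 p := by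
    rw [← lintegral_add_left (by fun_prop)]
    refine lintegral_mono fun p => ?_
    rcases le_total (intKernel α 1 p) (squareKernel α 1 p) with hp | hp
    · exact (mul_le_mul_left hp _).trans le_add_self
    · exact (mul_le_mul_right hp _).trans le_self_add
  rw [lintegral_intKernel_sq hα hα' zero_le_one, lintegral_squareKernel_sq hα hα' zero_le_one, h]
    at hle
  intro htop
  rw [htop, ENNReal.mul_top (by rw [Real.one_rpow]; simpa using h0), top_le_iff] at hle
  exact (ENNReal.add_lt_top.2 ⟨ENNReal.ofReal_lt_top, ENNReal.ofReal_lt_top⟩).ne hle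

lemma measurable_lintegral_crossIntegrand (α : ℝ) : Measurable fun s : ℝ =>
    ∫⁻ r in Set.Ioo 0 s, ENNReal.ofReal (crossIntegrand α s r) := by
  have hm : Measurable fun z : ℝ × ℝ => (Set.Ioo 0 z.1).indicator
      (fun r => ENNReal.ofReal (crossIntegrand α z.1 r)) z.2 := by
    refine Measurable.ite (p := fun z : ℝ × ℝ => z.2 ∈ Set.Ioo 0 z.1) ?_ (by fun_prop)
      measurable_const
    exact (measurableSet_lt measurable_const measurable_snd).inter
      (measurableSet_lt measurable_snd measurable_fst)
  simp_rw [← lintegral_indicator measurableSet_Ioo]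
  exact hm.lintegral_prod_right'

lemma crossConst_pos (α : ℝ) : 0 < crossConst α := by
  have hm' := measurable_lintegral_crossIntegrand α
  rw [crossConst, setLIntegral_pos_iff hm']
  have hsub : Set.Ioo (0 : ℝ) 1 ⊆ Function.support fun s : ℝ =>
      ∫⁻ r in Set.Ioo 0 s, ENNReal.ofReal (crossIntegrand α s r) := by
    intro s hs
    refine ne_of_gt ((setLIntegral_pos_iff (by fun_prop)).2 ?_)
    have : Set.Ioo 0 s ⊆ Function.support fun r => ENNReal.ofReal (crossIntegrand α s r) :=
      fun r hr => (ENNReal.ofReal_pos.2 (crossIntegrand_pos hr.1 hr.2 hs.2)).ne'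
    rw [Set.inter_eq_self_of_subset_right this]
    simpa using hs.1
  rw [Set.inter_eq_self_of_subset_right hsub]
  simp

lemma C₂_eq {α : ℝ} (hα : 1 / 2 < α) (hα' : α < 1) :
    C₂ α = dConst α * cConst ((α + 1) / 2) ^ 2 * (crossConst α).toReal := by
  have hm' := measurable_lintegral_crossIntegrand α
  rw [C₂]
  congr 1
  rw [intervalIntegral.integral_of_le zero_le_one, integral_Ioc_eq_integral_Ioo, crossConst,
    ← integral_toReal hm'.aemeasurable (ae_lt_top hm' (crossConst_ne_top hα hα'))]
  refine setIntegral_congr_fun measurableSet_Ioo fun s hs => ?_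
  rw [intervalIntegral.integral_of_le hs.1.le, integral_Ioc_eq_integral_Ioo,
    integral_eq_lintegral_of_nonneg_ae]
  · rfl
  · exact (ae_restrict_iff' measurableSet_Ioo).2 (ae_of_all _ fun r hr =>
      (crossIntegrand_pos hr.1 hr.2 hs.2).le)
  · exact Measurable.aestronglyMeasurable (by fun_prop)

end

section

/-! ## The kernel `Q` as a square-integrable function -/

/-- The fundamental theorem of calculus at the upper limit; the singularity at u = y has exponent
α/2-1 > -1. -/
lemma hasDerivAt_kernelK {α x y : ℝ} (hα : 0 < α) (hy : 0 < y) (hxy : y < x) :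
    HasDerivAt (fun x' => kernelK ((α + 1) / 2) x' y)
      (cConst ((α + 1) / 2) * (derivKernel α x y).toReal) x := by
  have hx : 0 < x := hy.trans hxy
  have h1 : 0 < x - y := sub_pos.2 hxy
  set f : ℝ → ℝ := fun u => (u - y) ^ ((α + 1) / 2 - 3 / 2) * u ^ ((α + 1) / 2 - 1 / 2) with hf
  have hint : IntervalIntegrable f volume y x := by
    refine IntervalIntegrable.mul_continuousOn ?_ ?_
    · have h := (intervalIntegral.intervalIntegrable_rpow' (r := (α + 1) / 2 - 3 / 2) (a := 0)
        (b := x - y) (by linarith)).comp_sub_right y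
      simpa using h
    · exact fun u _ => (Real.continuousAt_rpow_const _ _ (Or.inr (by linarith))).continuousWithinAt
  have hcont : ContinuousAt f x :=
    ((continuousAt_id.sub continuousAt_const).rpow_const (Or.inl h1.ne')).mul
      (Real.continuousAt_rpow_const _ _ (Or.inl hx.ne'))
  have hmeas : Measurable f := by fun_prop
  have h := (intervalIntegral.integral_hasDerivAt_right hint
    hmeas.stronglyMeasurable.stronglyMeasurableAtFilter hcont).const_mul
      (cConst ((α + 1) / 2) * y ^ (1 / 2 - (α + 1) / 2))
  refine h.congr_deriv ?_
  rw [derivKernel, if_pos ⟨hy, hxy⟩, ENNReal.toReal_ofReal (by positivity), hf,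
    show (1 : ℝ) / 2 - (α + 1) / 2 = -α / 2 by ring,
    show (α + 1) / 2 - 3 / 2 = α / 2 - 1 by ring, show (α + 1) / 2 - (1 : ℝ) / 2 = α / 2 by ring]
  ring

lemma derivKernel_ne_top (α x y : ℝ) : derivKernel α x y ≠ ∞ := by
  rw [derivKernel]
  split_ifs <;> simp

/-- The lower limit y₁ ∨ y₂ is automatic, since one derivative kernel vanishes below it. Excluding
the boundary, a null set, lets closed and open squares be identified. -/
lemma kernelQ_eq {α t y₁ y₂ : ℝ} (hα : 0 < α) (h1 : y₁ ≠ 0) (h2 : y₂ ≠ 0) (h1t : y₁ ≠ t)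
    (h2t : y₂ ≠ t) :
    kernelQ α t y₁ y₂ =
      dConst α * cConst ((α + 1) / 2) ^ 2 * (intKernel α t (y₁, y₂)).toReal := by
  by_cases hy : y₁ ∈ Set.Ioo 0 t ∧ y₂ ∈ Set.Ioo 0 t
  · obtain ⟨hy₁, hy₂⟩ := hy
    have hm : max y₁ y₂ < t := max_lt hy₁.2 hy₂.2
    have e : intKernel α t (y₁, y₂) = ∫⁻ x in Set.Ioo (max y₁ y₂) t,
        derivKernel α x y₁ * derivKernel α x y₂ := by
      rw [intKernel, ← lintegral_indicator measurableSet_Ioo,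
        ← lintegral_indicator measurableSet_Ioo]
      refine lintegral_congr fun x => ?_
      by_cases hx : max y₁ y₂ < x
      · have h0 : 0 < x := (hy₁.1.trans_le (le_max_left _ _)).trans hx
        simp only [Set.indicator_apply, Set.mem_Ioo, hx, h0, true_and]
      · rw [Set.indicator_of_notMem (s := Set.Ioo (max y₁ y₂) t) (fun h => hx h.1),
          Set.indicator_apply_eq_zero]
        intro _
        rw [max_lt_iff, not_and_or] at hx
        rcases hx with hx | hx
        · simp [derivKernel, hx]
        · simp [derivKernel, hx]
    rw [kernelQ, Set.indicator_of_mem (Set.Ioo_subset_Icc_self hy₁),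
      Set.indicator_of_mem (Set.Ioo_subset_Icc_self hy₂), mul_one, mul_one, mul_assoc, e,
      intervalIntegral.integral_of_le hm.le, integral_Ioc_eq_integral_Ioo,
      ← integral_toReal (Measurable.aemeasurable (by fun_prop)) (ae_of_all _ fun x =>
        ENNReal.mul_lt_top (derivKernel_ne_top _ _ _).lt_top (derivKernel_ne_top _ _ _).lt_top)]
    congr 1
    rw [← integral_const_mul]
    refine setIntegral_congr_fun measurableSet_Ioo fun x hx => ?_
    rw [(hasDerivAt_kernelK hα hy₁.1 ((le_max_left _ _).trans_lt hx.1)).deriv,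
      (hasDerivAt_kernelK hα hy₂.1 ((le_max_right _ _).trans_lt hx.1)).deriv, ENNReal.toReal_mul]
    ring
  · have e : intKernel α t (y₁, y₂) = 0 := by
      rw [intKernel, setLIntegral_congr_fun (g := fun _ => 0) measurableSet_Ioo, lintegral_zero]
      intro x hx
      simp only
      by_contra h
      have ha : 0 < y₁ ∧ y₁ < x := by
        by_contra h'
        exact h (by rw [derivKernel, if_neg h', zero_mul])
      have hb : 0 < y₂ ∧ y₂ < x := by
        by_contra h'
        exact h (by rw [mul_comm, derivKernel, if_neg h', zero_mul])
      exact hy ⟨⟨ha.1, ha.2.trans hx.2⟩, ⟨hb.1, hb.2.trans hx.2⟩⟩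
    rw [e, ENNReal.toReal_zero, mul_zero, kernelQ]
    have key : ∀ y : ℝ, y ≠ 0 → y ≠ t → y ∉ Set.Ioo 0 t → y ∉ Set.Icc 0 t := fun y h0 ht hy h =>
      hy ⟨lt_of_le_of_ne h.1 h0.symm, lt_of_le_of_ne h.2 ht⟩
    rcases not_and_or.1 hy with h | h
    · rw [Set.indicator_of_notMem (key _ h1 h1t h)]
      ring
    · rw [Set.indicator_of_notMem (key _ h2 h2t h)]
      ring

lemma ae_prod_ne (c : ℝ) : ∀ᵐ p : ℝ × ℝ, p.1 ≠ c ∧ p.2 ≠ c := by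
  have h : ∀ᵐ y : ℝ, y ≠ c := by simp [ae_iff]
  exact (Measure.quasiMeasurePreserving_fst.ae h).and (Measure.quasiMeasurePreserving_snd.ae h)

lemma kernelQ_ae_eq {α : ℝ} (hα : 0 < α) (t : ℝ) :
    (fun p : ℝ × ℝ => kernelQ α t p.1 p.2) =ᵐ[volume]
      fun p => dConst α * cConst ((α + 1) / 2) ^ 2 * (intKernel α t p).toReal := by
  filter_upwards [ae_prod_ne 0, ae_prod_ne t] with p h0 ht
  exact kernelQ_eq hα h0.1 h0.2 ht.1 ht.2

/-- The one-parameter factor of the second kernel on a closed square. -/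
def closedSquareKernel (α t : ℝ) (p : ℝ × ℝ) : ℝ :=
  (Set.Icc 0 t ×ˢ Set.Icc 0 t).indicator (fun p => secondFactor α p.1 p.2) p

lemma closedSquareKernel_ae_eq (α t : ℝ) :
    closedSquareKernel α t =ᵐ[volume] fun p => (squareKernel α t p).toReal := by
  filter_upwards [ae_prod_ne 0, ae_prod_ne t] with p h0 ht
  have key : ∀ y : ℝ, y ≠ 0 → y ≠ t → (y ∈ Set.Icc 0 t ↔ y ∈ Set.Ioo 0 t) := fun y h0 ht =>
    ⟨fun h => ⟨lt_of_le_of_ne h.1 h0.symm, lt_of_le_of_ne h.2 ht⟩, fun h => ⟨h.1.le, h.2.le⟩⟩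
  have hiff : p ∈ Set.Icc 0 t ×ˢ Set.Icc 0 t ↔ p ∈ Set.Ioo 0 t ×ˢ Set.Ioo 0 t := by
    rw [Set.mem_prod, Set.mem_prod, key _ h0.1 ht.1, key _ h0.2 ht.2]
  by_cases h : p ∈ Set.Ioo 0 t ×ˢ Set.Ioo 0 t
  · rw [closedSquareKernel, Set.indicator_of_mem (hiff.2 h), squareKernel, Set.indicator_of_mem h,
      ENNReal.toReal_ofReal (secondFactor_nonneg α h.1.1.le h.2.1.le)]
  · rw [closedSquareKernel, Set.indicator_of_notMem (fun h' => h (hiff.1 h')), squareKernel,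
      Set.indicator_of_notMem h, ENNReal.toReal_zero]

/-! ### From extended nonnegative integrals to real inner products -/

lemma ae_lt_top_of_lintegral_sq {X : Type*} [MeasurableSpace X] {μ : Measure X} {f : X → ℝ≥0∞}
    (hf : Measurable f) (h : ∫⁻ x, f x * f x ∂μ ≠ ∞) : ∀ᵐ x ∂μ, f x < ∞ := by
  filter_upwards [ae_lt_top (hf.mul hf) h] with x hx
  by_contra h'
  rw [not_lt, top_le_iff] at h'
  simp [h'] at hx

lemma memLp_two_toReal {X : Type*} [MeasurableSpace X] {μ : Measure X} {f : X → ℝ≥0∞}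
    (hf : Measurable f) (h : ∫⁻ x, f x * f x ∂μ ≠ ∞) : MemLp (fun x => (f x).toReal) 2 μ := by
  rw [memLp_two_iff_integrable_sq hf.ennreal_toReal.aestronglyMeasurable]
  refine (integrable_toReal_of_lintegral_ne_top (hf.mul hf).aemeasurable h).congr ?_
  exact ae_of_all _ fun x => by simp only [Pi.mul_apply, ENNReal.toReal_mul, sq]

lemma integral_toReal_mul_toReal {X : Type*} [MeasurableSpace X] {μ : Measure X}
    {f g : X → ℝ≥0∞} (hf : Measurable f) (hg : Measurable g) (h : ∫⁻ x, f x * f x ∂μ ≠ ∞)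
    (h' : ∫⁻ x, g x * g x ∂μ ≠ ∞) :
    ∫ x, (f x).toReal * (g x).toReal ∂μ = (∫⁻ x, f x * g x ∂μ).toReal := by
  rw [← integral_toReal (f := fun x => f x * g x) (hf.mul hg).aemeasurable]
  · simp_rw [ENNReal.toReal_mul]
  · filter_upwards [ae_lt_top_of_lintegral_sq hf h, ae_lt_top_of_lintegral_sq hg h'] with x h1 h2
    exact ENNReal.mul_lt_top h1 h2

variable {α : ℝ}

/-- The normalization behind ‖Q_α(t)‖² = t^{2α}/2: c² is α(α+1)/2 over the same beta value, and d²
cancels the rest. -/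
lemma dConst_mul_cConst_sq (hα : 1 / 2 < α) (hα' : α < 1) :
    (dConst α * cConst ((α + 1) / 2) ^ 2) ^ 2 *
      (beta (1 - α) (α / 2) ^ 2 / (α * (2 * α - 1))) = 1 / 2 := by
  have hb : 0 < beta (1 - α) (α / 2) := beta_pos (by linarith) (by linarith)
  have h0 : 0 < α := by linarith
  have h1 : 0 < 2 * α - 1 := by linarith
  have hc : cConst ((α + 1) / 2) ^ 2 = (α + 1) / 2 * α / beta (1 - α) (α / 2) := by
    rw [cConst, show 2 - 2 * ((α + 1) / 2) = 1 - α by ring,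
      show (α + 1) / 2 - 1 / 2 = α / 2 by ring, show 2 * ((α + 1) / 2) - 1 = α by ring,
      Real.sq_sqrt (by positivity)]
  rw [hc, mul_pow, dConst, mul_pow, Real.sq_sqrt (by positivity)]
  generalize 2 * α - 1 = w at h1
  field_simp

lemma intKernel_sq_ne_top (hα : 1 / 2 < α) (hα' : α < 1) {t : ℝ} (ht : 0 ≤ t) :
    ∫⁻ p, intKernel α t p * intKernel α t p ≠ ∞ := by
  rw [lintegral_intKernel_sq hα hα' ht]
  exact ENNReal.ofReal_ne_top

lemma squareKernel_sq_ne_top (hα : 1 / 2 < α) (hα' : α < 1) {t : ℝ} (ht : 0 ≤ t) :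
    ∫⁻ p, squareKernel α t p * squareKernel α t p ≠ ∞ := by
  rw [lintegral_squareKernel_sq hα hα' ht]
  exact ENNReal.ofReal_ne_top

lemma memLp_kernelQ (hα : 1 / 2 < α) (hα' : α < 1) {t : ℝ} (ht : 0 ≤ t) :
    MemLp (fun p : ℝ × ℝ => kernelQ α t p.1 p.2) 2 :=
  ((memLp_two_toReal (measurable_intKernel α t) (intKernel_sq_ne_top hα hα' ht)).const_mul _).ae_eq
    (kernelQ_ae_eq (by linarith) t).symm

lemma memLp_closedSquareKernel (hα : 1 / 2 < α) (hα' : α < 1) {t : ℝ} (ht : 0 ≤ t) :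
    MemLp (closedSquareKernel α t) 2 :=
  (memLp_two_toReal (measurable_squareKernel α t) (squareKernel_sq_ne_top hα hα' ht)).ae_eq
    (closedSquareKernel_ae_eq α t).symm

lemma integral_kernelQ_sq (hα : 1 / 2 < α) (hα' : α < 1) {t : ℝ} (ht : 0 ≤ t) :
    ∫ p : ℝ × ℝ, kernelQ α t p.1 p.2 * kernelQ α t p.1 p.2 = t ^ (2 * α) / 2 := by
  have h0 : 0 < α := by linarith
  have h1 : 0 < 2 * α - 1 := by linarith
  have hae : (fun p : ℝ × ℝ => kernelQ α t p.1 p.2 * kernelQ α t p.1 p.2) =ᵐ[volume]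
      fun p => (dConst α * cConst ((α + 1) / 2) ^ 2) ^ 2 *
        ((intKernel α t p).toReal * (intKernel α t p).toReal) := by
    filter_upwards [kernelQ_ae_eq h0 t] with p hp
    rw [hp]
    ring
  rw [integral_congr_ae hae, integral_const_mul,
    integral_toReal_mul_toReal (measurable_intKernel α t) (measurable_intKernel α t)
      (intKernel_sq_ne_top hα hα' ht) (intKernel_sq_ne_top hα hα' ht),
    lintegral_intKernel_sq hα hα' ht, ENNReal.toReal_ofReal (by positivity)]
  linear_combination t ^ (2 * α) * dConst_mul_cConst_sq hα hα'

lemma integral_kernelQ_mul (hα : 1 / 2 < α) (hα' : α < 1) {t : ℝ} (ht : 0 ≤ t) :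
    ∫ p : ℝ × ℝ, kernelQ α t p.1 p.2 * closedSquareKernel α t p = C₂ α * (t ^ (2 * α) / α) := by
  have h0 : 0 < α := by linarith
  have hae : (fun p : ℝ × ℝ => kernelQ α t p.1 p.2 * closedSquareKernel α t p) =ᵐ[volume]
      fun p => (dConst α * cConst ((α + 1) / 2) ^ 2) *
        ((intKernel α t p).toReal * (squareKernel α t p).toReal) := by
    filter_upwards [kernelQ_ae_eq h0 t, closedSquareKernel_ae_eq α t] with p hp hp'
    rw [hp, hp']
    ring
  rw [integral_congr_ae hae, integral_const_mul,
    integral_toReal_mul_toReal (measurable_intKernel α t) (measurable_squareKernel α t)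
      (intKernel_sq_ne_top hα hα' ht) (squareKernel_sq_ne_top hα hα' ht),
    lintegral_intKernel_mul h0 ht, ENNReal.toReal_mul, ENNReal.toReal_ofReal (by positivity),
    C₂_eq hα hα']
  ring

lemma integral_closedSquareKernel_sq (hα : 1 / 2 < α) (hα' : α < 1) {t : ℝ} (ht : 0 ≤ t) :
    ∫ p : ℝ × ℝ, closedSquareKernel α t p * closedSquareKernel α t p =
      beta (1 - α) (2 * α - 1) * (t ^ (2 * α) / α) := by
  have h0 : 0 < α := by linarith
  have hb : 0 < beta (1 - α) (2 * α - 1) := beta_pos (by linarith) (by linarith)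
  have hae : (fun p : ℝ × ℝ => closedSquareKernel α t p * closedSquareKernel α t p) =ᵐ[volume]
      fun p => (squareKernel α t p).toReal * (squareKernel α t p).toReal := by
    filter_upwards [closedSquareKernel_ae_eq α t] with p hp
    rw [hp]
  rw [integral_congr_ae hae,
    integral_toReal_mul_toReal (measurable_squareKernel α t) (measurable_squareKernel α t)
      (squareKernel_sq_ne_top hα hα' ht) (squareKernel_sq_ne_top hα hα' ht),
    lintegral_squareKernel_sq hα hα' ht, ENNReal.toReal_ofReal (by positivity)]

lemma C₂_pos (hα : 1 / 2 < α) (hα' : α < 1) : 0 < C₂ α := by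
  have h0 : 0 < α := by linarith
  have h1 : 0 < 2 * α - 1 := by linarith
  have hc : 0 < cConst ((α + 1) / 2) := by
    have hb : 0 < beta (2 - 2 * ((α + 1) / 2)) ((α + 1) / 2 - 1 / 2) :=
      beta_pos (by linarith) (by linarith)
    refine Real.sqrt_pos.2 (div_pos (mul_pos (by linarith) (by linarith)) hb)
  have hd : 0 < dConst α := by
    unfold dConst
    positivity
  rw [C₂_eq hα hα']
  have := ENNReal.toReal_pos (crossConst_pos α).ne' (crossConst_ne_top hα hα')
  positivity

end

section

/-! ## Tensor products -/

/-- Exchange of the two middle coordinates. -/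
def middleSwap (z : (ℝ × ℝ) × (ℝ × ℝ)) : (ℝ × ℝ) × (ℝ × ℝ) := ((z.1.1, z.2.1), (z.1.2, z.2.2))

lemma measurePreserving_middleSwap : MeasurePreserving middleSwap volume volume := by
  have a1 : MeasurePreserving (MeasurableEquiv.prodAssoc : (ℝ × ℝ) × (ℝ × ℝ) ≃ᵐ _) volume volume :=
    volume_preserving_prodAssoc
  have a2 : MeasurePreserving (MeasurableEquiv.prodAssoc : (ℝ × ℝ) × ℝ ≃ᵐ ℝ × (ℝ × ℝ))
    volume volume := volume_preserving_prodAssoc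
  have sw : MeasurePreserving (Prod.swap : ℝ × ℝ → ℝ × ℝ) volume volume :=
    Measure.measurePreserving_swap
  have idp : MeasurePreserving (id : ℝ → ℝ) volume volume := MeasurePreserving.id _
  have b1 := idp.prod ((a2.comp (sw.prod idp)).comp (a2.symm _))
  exact (a1.symm _).comp (b1.comp a1)

/-- The tensor product of two functions of two variables, with the variables in the order used by
the double Wiener integral. -/
def tensor (f g : ℝ × ℝ → ℝ) (z : (ℝ × ℝ) × (ℝ × ℝ)) : ℝ := f (z.1.1, z.2.1) * g (z.1.2, z.2.2)

lemma memLp_tensor {f g : ℝ × ℝ → ℝ} (hf : MemLp f 2) (hg : MemLp g 2) :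
    MemLp (tensor f g) 2 := by
  have h : MemLp (fun p : (ℝ × ℝ) × (ℝ × ℝ) => f p.1 * g p.2) 2 := by
    have hm : AEStronglyMeasurable (fun p : (ℝ × ℝ) × (ℝ × ℝ) => f p.1 * g p.2) volume :=
      hf.1.comp_fst.mul hg.1.comp_snd
    rw [memLp_two_iff_integrable_sq hm]
    simp_rw [mul_pow]
    exact hf.integrable_sq.mul_prod hg.integrable_sq
  exact h.comp_measurePreserving measurePreserving_middleSwap

lemma integral_tensor_mul {f g f' g' : ℝ × ℝ → ℝ} (hf : MemLp f 2) (hg : MemLp g 2)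
    (hf' : MemLp f' 2) (hg' : MemLp g' 2) :
    ∫ z, tensor f g z * tensor f' g' z = (∫ p, f p * f' p) * ∫ p, g p * g' p := by
  have hm : AEStronglyMeasurable (fun w : (ℝ × ℝ) × (ℝ × ℝ) => (f w.1 * f' w.1) * (g w.2 * g' w.2))
      volume := (hf.1.mul hf'.1).comp_fst.mul (hg.1.mul hg'.1).comp_snd
  have mp := measurePreserving_middleSwap
  rw [← integral_prod_mul (fun p => f p * f' p) (fun p => g p * g' p), ← Measure.volume_eq_prod]
  conv_rhs => rw [← mp.map_eq]
  rw [integral_map mp.measurable.aemeasurable (by rwa [mp.map_eq])]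
  refine integral_congr_ae (ae_of_all _ fun z => ?_)
  simp only [tensor, middleSwap]
  ring

/-- The closed supports leave the open quadrant only on coordinate hyperplanes, which are null. -/
lemma tensor_eq_zero_ae {f g : ℝ × ℝ → ℝ} {t s : ℝ}
    (hf : ∀ p, p ∉ Set.Icc 0 t ×ˢ Set.Icc 0 t → f p = 0)
    (hg : ∀ p, p ∉ Set.Icc 0 s ×ˢ Set.Icc 0 s → g p = 0) :
    ∀ᵐ z, z ∉ quadrantSq → tensor f g z = 0 := by
  have h1 : ∀ᵐ z : (ℝ × ℝ) × (ℝ × ℝ), z.1.1 ≠ 0 ∧ z.1.2 ≠ 0 :=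
    Measure.quasiMeasurePreserving_fst.ae (ae_prod_ne 0)
  have h2 : ∀ᵐ z : (ℝ × ℝ) × (ℝ × ℝ), z.2.1 ≠ 0 ∧ z.2.2 ≠ 0 :=
    Measure.quasiMeasurePreserving_snd.ae (ae_prod_ne 0)
  filter_upwards [h1, h2] with z h1 h2 hz
  by_contra hne
  have hp : (z.1.1, z.2.1) ∈ Set.Icc 0 t ×ˢ Set.Icc 0 t := by
    by_contra h
    exact hne (by rw [tensor, hf _ h, zero_mul])
  have hq : (z.1.2, z.2.2) ∈ Set.Icc 0 s ×ˢ Set.Icc 0 s := by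
    by_contra h
    exact hne (by rw [tensor, hg _ h, mul_zero])
  exact hz ⟨⟨lt_of_le_of_ne hp.1.1 h1.1.symm, lt_of_le_of_ne hq.1.1 h1.2.symm⟩,
    ⟨lt_of_le_of_ne hp.2.1 h2.1.symm, lt_of_le_of_ne hq.2.1 h2.2.symm⟩⟩

/-! ## The mean square error -/

lemma kernelQ_eq_zero {α t : ℝ} (p : ℝ × ℝ) (hp : p ∉ Set.Icc 0 t ×ˢ Set.Icc 0 t) :
    kernelQ α t p.1 p.2 = 0 := by
  rw [kernelQ]
  rcases not_and_or.1 hp with h | h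
  · rw [Set.indicator_of_notMem h]
    ring
  · rw [Set.indicator_of_notMem h]
    ring

lemma kernelQ_comm (α t x y : ℝ) : kernelQ α t x y = kernelQ α t y x := by
  rw [kernelQ, kernelQ, max_comm]
  simp_rw [mul_comm (deriv (fun x' => kernelK ((α + 1) / 2) x' x) _)]
  ring

lemma closedSquareKernel_eq_zero {α t : ℝ} (p : ℝ × ℝ) (hp : p ∉ Set.Icc 0 t ×ˢ Set.Icc 0 t) :
    closedSquareKernel α t p = 0 := Set.indicator_of_notMem hp _

lemma closedSquareKernel_comm (α t x y : ℝ) :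
    closedSquareKernel α t (x, y) = closedSquareKernel α t (y, x) := by
  simp only [closedSquareKernel, Set.indicator_apply, Set.mem_prod, secondFactor_comm α x y]
  simp only [and_comm]

/-- The coefficient of `t^{2α} s^{2β}` in the mean square error. -/
def errorCoeff (α β k : ℝ) : ℝ :=
  1 - 8 * k * (C₂ α * C₂ β) / (α * β) + 4 * k ^ 2 * betaProd α β / (α * β)

variable {Ω : Type*} [MeasurableSpace Ω] {P : Measure Ω} {B : ℝ≥0 × ℝ≥0 → Ω → ℝ} {α β : ℝ}

/-- The 2 in the error and the 2 of the isometry give 4‖g - kw‖². Each of the three terms of the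
expanded square factors into plane integrals; the leading one is 4 · 1/2 · 1/2 = 1. -/
lemma sqError_secondKernel (hB : IsBrownianSheet B P) (hα : 1 / 2 < α) (hα' : α < 1)
    (hβ : 1 / 2 < β) (hβ' : β < 1) (k : ℝ) {t s : ℝ} (ht : 0 ≤ t) (hs : 0 ≤ s) :
    sqError B P α β (secondKernel α β k) t s =
      errorCoeff α β k * (t ^ (2 * α) * s ^ (2 * β)) := by
  have hα0 : 0 < α := by linarith
  have hβ0 : 0 < β := by linarith
  set D : Set ((ℝ × ℝ) × (ℝ × ℝ)) :=
    (Set.Icc 0 t ×ˢ Set.Icc 0 s) ×ˢ (Set.Icc 0 t ×ˢ Set.Icc 0 s) with hD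
  set g := tensor (fun p => kernelQ α t p.1 p.2) (fun p => kernelQ β s p.1 p.2) with hg
  set w := tensor (closedSquareKernel α t) (closedSquareKernel β s) with hw
  have e1 : (D.indicator fun z => kernelQ α t z.1.1 z.2.1 * kernelQ β s z.1.2 z.2.2) = g := by
    funext z
    by_cases hz : z ∈ D
    · rw [Set.indicator_of_mem hz]
      rfl
    · rw [Set.indicator_of_notMem hz, hg, tensor]
      have : (z.1.1, z.2.1) ∉ Set.Icc 0 t ×ˢ Set.Icc 0 t ∨
          (z.1.2, z.2.2) ∉ Set.Icc 0 s ×ˢ Set.Icc 0 s := by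
        by_contra! h
        exact hz ⟨⟨h.1.1, h.2.1⟩, ⟨h.1.2, h.2.2⟩⟩
      rcases this with h | h
      · rw [kernelQ_eq_zero _ h, zero_mul]
      · rw [kernelQ_eq_zero _ h, mul_zero]
  have e2 : (D.indicator fun z => secondKernel α β k z.1.1 z.2.1 z.1.2 z.2.2) =
      fun z => k * w z := by
    funext z
    by_cases hz : z ∈ D
    · rw [Set.indicator_of_mem hz, hw, tensor, closedSquareKernel, closedSquareKernel,
        Set.indicator_of_mem (show (z.1.1, z.2.1) ∈ Set.Icc 0 t ×ˢ Set.Icc 0 t from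
          ⟨hz.1.1, hz.2.1⟩),
        Set.indicator_of_mem (show (z.1.2, z.2.2) ∈ Set.Icc 0 s ×ˢ Set.Icc 0 s from
          ⟨hz.1.2, hz.2.2⟩), secondKernel, secondFactor, secondFactor]
      ring
    · rw [Set.indicator_of_notMem hz, hw, tensor]
      have : (z.1.1, z.2.1) ∉ Set.Icc 0 t ×ˢ Set.Icc 0 t ∨
          (z.1.2, z.2.2) ∉ Set.Icc 0 s ×ˢ Set.Icc 0 s := by
        by_contra! h
        exact hz ⟨⟨h.1.1, h.2.1⟩, ⟨h.1.2, h.2.2⟩⟩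
      rcases this with h | h
      · rw [closedSquareKernel_eq_zero _ h, zero_mul, mul_zero]
      · rw [closedSquareKernel_eq_zero _ h, mul_zero, mul_zero]
  have mQ := memLp_kernelQ hα hα' ht
  have mQ' := memLp_kernelQ hβ hβ' hs
  have mW := memLp_closedSquareKernel hα hα' ht
  have mW' := memLp_closedSquareKernel hβ hβ' hs
  have mg : MemLp g 2 := memLp_tensor mQ mQ'
  have mw : MemLp w 2 := memLp_tensor mW mW'
  have key := hB.integral_sub_sq mg (mw.const_mul k)
    (tensor_eq_zero_ae (fun p => kernelQ_eq_zero p) (fun p => kernelQ_eq_zero p))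
    ((tensor_eq_zero_ae (fun p => closedSquareKernel_eq_zero (α := α) (t := t) p)
      (fun p => closedSquareKernel_eq_zero (α := β) (t := s) p)).mono fun z hz hzq => by
        rw [hw, hz hzq, mul_zero])
    (fun z => by simp only [hg, tensor, Prod.fst_swap, Prod.snd_swap]
                 rw [kernelQ_comm α, kernelQ_comm β])
    (fun z => by simp only [hw, tensor, Prod.fst_swap, Prod.snd_swap]
                 rw [closedSquareKernel_comm α, closedSquareKernel_comm β])
  have e3 : ∀ z, (g z - k * w z) ^ 2 = (g z + (-k) * w z) ^ 2 := fun z => by ring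
  simp_rw [e3] at key
  rw [integral_add_mul_sq mg mw] at key
  simp_rw [sq (g _), sq (w _)] at key
  rw [hg, hw, integral_tensor_mul mQ mQ' mQ mQ', integral_tensor_mul mQ mQ' mW mW',
    integral_tensor_mul mW mW' mW mW', integral_kernelQ_sq hα hα' ht, integral_kernelQ_sq hβ hβ' hs,
    integral_kernelQ_mul hα hα' ht, integral_kernelQ_mul hβ hβ' hs,
    integral_closedSquareKernel_sq hα hα' ht, integral_closedSquareKernel_sq hβ hβ' hs] at key
  simp only [sqError, rosenblattSheet, doubleIntegral]
  rw [← hD, e1, e2, key, errorCoeff, betaProd]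
  field_simp
  ring

lemma isGreatest_errorValues (hB : IsBrownianSheet B P) (hα : 1 / 2 < α) (hα' : α < 1)
    (hβ : 1 / 2 < β) (hβ' : β < 1) (k : ℝ) {T S : ℝ} (hT : 0 < T) (hS : 0 < S) :
    IsGreatest (errorValues B P α β T S (secondKernel α β k))
      (errorCoeff α β k * (T ^ (2 * α) * S ^ (2 * β))) := by
  -- The coefficient is the error at t = s = 1, hence nonnegative; so the error increases in t and
  -- s.
  have hcoeff : 0 ≤ errorCoeff α β k := by
    have h := sqError_secondKernel hB hα hα' hβ hβ' k zero_le_one zero_le_one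
    rw [Real.one_rpow, Real.one_rpow, mul_one, mul_one] at h
    rw [← h, sqError]
    exact mul_nonneg zero_le_two (integral_nonneg fun ω => sq_nonneg _)
  refine ⟨⟨T, ⟨hT.le, le_rfl⟩, S, ⟨hS.le, le_rfl⟩,
    (sqError_secondKernel hB hα hα' hβ hβ' k hT.le hS.le).symm⟩, ?_⟩
  rintro _ ⟨t, ht, s, hs, rfl⟩
  rw [sqError_secondKernel hB hα hα' hβ hβ' k ht.1 hs.1]
  refine mul_le_mul_of_nonneg_left ?_ hcoeff
  exact mul_le_mul (Real.rpow_le_rpow ht.1 ht.2 (by linarith))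
    (Real.rpow_le_rpow hs.1 hs.2 (by linarith)) (Real.rpow_nonneg hs.1 _)
    (Real.rpow_nonneg hT.le _)

lemma betaProd_pos (hα : 1 / 2 < α) (hα' : α < 1) (hβ : 1 / 2 < β) (hβ' : β < 1) :
    0 < betaProd α β :=
  mul_pos (beta_pos (by linarith) (by linarith)) (beta_pos (by linarith) (by linarith))

lemma kStar_pos (hα : 1 / 2 < α) (hα' : α < 1) (hβ : 1 / 2 < β) (hβ' : β < 1) :
    0 < kStar α β :=
  div_pos (mul_pos (C₂_pos hα hα') (C₂_pos hβ hβ')) (betaProd_pos hα hα' hβ hβ')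

/-- Completing the square in k: the vertex is `kStar` and the constant term is the optimal
coefficient. -/
lemma errorCoeff_eq (hα : 1 / 2 < α) (hα' : α < 1) (hβ : 1 / 2 < β) (hβ' : β < 1) (k : ℝ) :
    errorCoeff α β k = (1 - 4 * C₂ α ^ 2 * C₂ β ^ 2 / (α * β * betaProd α β)) +
      4 * betaProd α β / (α * β) * (k - kStar α β) ^ 2 := by
  have hp := betaProd_pos hα hα' hβ hβ'
  have hα0 : 0 < α := by linarith
  have hβ0 : 0 < β := by linarith
  rw [errorCoeff, kStar]
  field_simp
  ring

end

end RosenblattSheet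

end

/-! ### Minimization over k -/

theorem theorem6p2 {Ω : Type*} [MeasurableSpace Ω] (P : MeasureTheory.Measure Ω)
    [MeasureTheory.IsProbabilityMeasure P] (B : NNReal × NNReal → Ω → ℝ)
    (hB : RosenblattSheet.IsBrownianSheet B P)
    (α β T S : ℝ) (hα : 1 / 2 < α) (hα' : α < 1) (hβ : 1 / 2 < β) (hβ' : β < 1)
    (hT : 0 < T) (hS : 0 < S) :
    (∀ ζ ∈ RosenblattSheet.classK₂ α β,
      BddAbove (RosenblattSheet.errorValues B P α β T S ζ)) ∧
    IsGLB ((fun ζ => sSup (RosenblattSheet.errorValues B P α β T S ζ)) ''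
        RosenblattSheet.classK₂ α β)
      (RosenblattSheet.optimalValue α β T S) ∧
    0 < RosenblattSheet.kStar α β ∧
    sSup (RosenblattSheet.errorValues B P α β T S
        (RosenblattSheet.secondKernel α β (RosenblattSheet.kStar α β))) =
      RosenblattSheet.optimalValue α β T S := by
  open RosenblattSheet in
  have hsup : ∀ k, sSup (errorValues B P α β T S (secondKernel α β k)) =
      errorCoeff α β k * (T ^ (2 * α) * S ^ (2 * β)) := fun k =>
    (isGreatest_errorValues hB hα hα' hβ hβ' k hT hS).csSup_eq
  have hstar : sSup (errorValues B P α β T S (secondKernel α β (kStar α β))) =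
      optimalValue α β T S := by
    rw [hsup, errorCoeff_eq hα hα' hβ hβ', optimalValue, sub_self]
    ring
  have hpos := kStar_pos hα hα' hβ hβ'
  refine ⟨?_, IsLeast.isGLB ⟨⟨_, ⟨_, hpos, rfl⟩, hstar⟩, ?_⟩, hpos, hstar⟩
  -- Boundedness excludes the default value 0 that `sSup` takes on unbounded sets.
  · rintro _ ⟨k, -, rfl⟩
    exact (isGreatest_errorValues hB hα hα' hβ hβ' k hT hS).bddAbove
  · rintro _ ⟨_, ⟨k, -, rfl⟩, rfl⟩
    simp only [hsup]
    have hα0 : 0 < α := by linarith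
    have hβ0 : 0 < β := by linarith
    have hp := betaProd_pos hα hα' hβ hβ'
    rw [errorCoeff_eq hα hα' hβ hβ', optimalValue, mul_assoc]
    refine mul_le_mul_of_nonneg_right (le_add_of_nonneg_right ?_) (by positivity)
    positivity
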